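/- For a finite poset $P$ let $c_k$ (resp. $a_k$) be the maximal cardinality of a union of $k$ chains (resp. antichains) of $P$, and let $\lambda(P)$ be the Young diagram whose $k$-th row has length $c_k-c_{k-1}$ and whose $k$-th column has length $a_k-a_{k-1}$ for all $k\ge 1$ (such a diagram exists by Greene's duality theorem; rows are numbered from top to bottom). Let $n \geq 0$, let $\sigma$ be a permutation of $[n]=\{1,\dots,n\}$, and let $P_\sigma=\{(k,\sigma(k)) : k\in[n]\}$ with the partial order induced from the product order: $(k,\sigma(k))\le(l,\sigma(l))$ if and only if $k\le l$ and $\sigma(k)\le\sigma(l)$. For $0\le i,j\le n$ put $\lambda_{ij}=\lambda\bigl(P_\sigma\cap([i]\times[j])\bigr)$, where $[0]=\varnothing$. Then every $\lambda_{ij}$ with $0\le i,j\le n$ is well defined, i.e. there is a Young diagram with the row lengths and the column lengths prescribed above. Moreover, for all $i,j\in\{1,\dots,n\}$ the shape $\lambda_{ij}$ is uniquely determined by $\lambda_{i-1,j-1}$, $\lambda_{i,j-1}$, $\lambda_{i-1,j}$ and whether or not $\sigma(i)=j$ (by a rule that does not depend on $n,\sigma,i,j$), namely as follows. 1. If $\lambda_{i,j-1}\neq\lambda_{i-1,j}$,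 then $\lambda_{ij}=\lambda_{i,j-1}\cup\lambda_{i-1,j}$. 2. If $\lambda_{i,j-1}=\lambda_{i-1,j}=\lambda_{i-1,j-1}$ and $\sigma(i)\neq j$, then $\lambda_{ij}=\lambda_{i-1,j-1}$. 3. If $\lambda_{i,j-1}=\lambda_{i-1,j}=\lambda_{i-1,j-1}$ and $\sigma(i)=j$, then $\lambda_{ij}$ is obtained by adding a box to the first row of $\lambda_{i-1,j-1}$. 4. If $\lambda_{i,j-1}=\lambda_{i-1,j}\neq\lambda_{i-1,j-1}$, then $\lambda_{i-1,j}$ is obtained from $\lambda_{i-1,j-1}$ by adding a single box $A$, and $\lambda_{ij}$ is obtained from $\lambda_{i-1,j}$ by adding a box to the row immediately below the row of $A$. -/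

import Mathlib

namespace Greene

section

variable {α : Type*} [PartialOrder α]

open Classical in
/-- `c_k`: the maximal cardinality of a union of `k` chains of the finite poset `P`
(with the order induced from the ambient partial order). -/
noncomputable def chainNum (P : Finset α) (k : ℕ) : ℕ :=
  (P.powerset.filter fun S : Finset α => ∃ C : Fin k → Set α,
    (∀ t, IsChain (· ≤ ·) (C t)) ∧ (S : Set α) = ⋃ t, C t).sup Finset.card

open Classical in
/-- `a_k`: the maximal cardinality of a union of `k` antichains of the finite poset `P`. -/
noncomputable def antichainNum (P : Finset α) (k : ℕ) : ℕ :=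
  (P.powerset.filter fun S : Finset α => ∃ A : Fin k → Set α,
    (∀ t, IsAntichain (· ≤ ·) (A t)) ∧ (S : Set α) = ⋃ t, A t).sup Finset.card

/-- `μ` is the shape of the finite poset `P`: its row lengths are `c_k - c_{k-1}` and its
column lengths are `a_k - a_{k-1}`, for `k ≥ 1`. (Rows and columns of a `YoungDiagram` are
numbered from `0`; both sequences `c` and `a` are weakly increasing.) -/
def IsShape (P : Finset α) (μ : YoungDiagram) : Prop :=
  (∀ k : ℕ, μ.rowLen k = chainNum P (k + 1) - chainNum P k) ∧
  (∀ k : ℕ, μ.colLen k = antichainNum P (k + 1) - antichainNum P k)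

open Classical in
/-- `λ(P)`: the Young diagram whose row lengths and column lengths are as in `IsShape`. A diagram
is determined by its row lengths, so there is at most one. That there is one, so that the default
value is not taken, is asserted explicitly wherever `shape` is used. -/
noncomputable def shape (P : Finset α) : YoungDiagram :=
  if h : ∃ μ : YoungDiagram, IsShape P μ then h.choose else ⊥

end

/-- The permutation poset `P_σ`: the points `(k, σ(k))`, `1 ≤ k ≤ n`, ordered as a subset of the
product `ℕ × ℕ`. The element `k : Fin n` stands for the number `k + 1` of `{1, …, n}`. -/
def permPoset {n : ℕ} (σ : Equiv.Perm (Fin n)) : Finset (ℕ × ℕ) :=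
  Finset.univ.image fun k : Fin n => ((k : ℕ) + 1, (σ k : ℕ) + 1)

/-- The order ideal `P_σ(i, j) = ([i] × [j]) ∩ P_σ`. -/
def permIdeal {n : ℕ} (σ : Equiv.Perm (Fin n)) (i j : ℕ) : Finset (ℕ × ℕ) :=
  (Finset.Icc 1 i ×ˢ Finset.Icc 1 j) ∩ permPoset σ

/-- The growth diagram `λ_{ij} = λ(P_σ(i, j))` of `σ`. -/
noncomputable def growth {n : ℕ} (σ : Equiv.Perm (Fin n)) (i j : ℕ) : YoungDiagram :=
  shape (permIdeal σ i j)

/-- `ν` is obtained from `μ` by adding the box `b`. -/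
def AddsBox (μ : YoungDiagram) (b : ℕ × ℕ) (ν : YoungDiagram) : Prop :=
  b ∉ μ ∧ ν.cells = insert b μ.cells

end Greene

/-! Existence of shapes rests on a conjugacy between the numbers `c_h` and `a_k`. A chain meets an
antichain in at most one point, so `c_h + a_k ≤ |P| + h k` (`chainNum_add_antichainNum_le`). For
each `h` some `k` gives equality, and conversely: maximising the number of elements covered by
chains, at a price `k` per chain, is an assignment problem, and an integral optimal dual solution
(`exists_perm_and_tight_dual`) is a colouring by antichains. Hence `c` and `a` are concave and
determine each other as the rows and columns of one diagram.

For the growth rules, the main case is a unit square adding a point `p` in a new last column and a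
point `q` in a new last row. Both are maximal in the product order, while in the order `Southeast`
on incomparable pairs `p` is maximal and `q` minimal. Colourable sets for a strict order correspond
to integer labellings closed under pointwise maximum and minimum, and the total jump is modular.
This yields exchange inequalities for chains (`colorNum_exchange_of_max_min`) and for antichains
(`colorNum_exchange_of_max_max`). Together with the conjugacy they determine the chain numbers at
the fourth corner (`chainNum_of_bump_of_bump`): boxes added to different rows are both kept, and two
boxes added to the same row push one of them down a row. In the other squares the ideals on opposite
sides coincide, or the new point is a maximum and lengthens every longest chain. Induction on `i +
j` (`permIdeal_step`) shows that each edge of the growth diagram adds at most one box. -/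

namespace Greene

/-! ### Chains and antichains as colourings -/

section Coloring

variable {α : Type*}

/-- `f` colours `S` with the colours `0, …, k - 1` so that `R`-related elements get distinct
colours. -/
def IsColoring (R : α → α → Prop) (S : Finset α) (k : ℕ) (f : α → ℕ) : Prop :=
  (∀ x ∈ S, f x < k) ∧ ∀ x ∈ S, ∀ y ∈ S, R x y → f x ≠ f y

open Classical in
/-- The maximal cardinality of a subset of `P` that can be coloured with `k` colours so that
`R`-related elements get distinct colours. -/
noncomputable def colorNum (R : α → α → Prop) (P : Finset α) (k : ℕ) : ℕ :=
  (P.powerset.filter fun S => ∃ f, IsColoring R S k f).sup Finset.card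

variable {R : α → α → Prop} {P Q S : Finset α} {k l : ℕ}

theorem IsColoring.card_le_colorNum {f : α → ℕ} (h : IsColoring R S k f) (hS : S ⊆ P) :
    S.card ≤ colorNum R P k := by
  classical
  exact Finset.le_sup (f := Finset.card)
    (Finset.mem_filter.2 ⟨Finset.mem_powerset.2 hS, f, h⟩)

theorem card_le_colorNum_of_subtype (T : Finset {x // x ∈ P}) (f : {x // x ∈ P} → ℕ)
    (hf : ∀ p ∈ T, f p < k) (hR : ∀ p ∈ T, ∀ q ∈ T, R p q → f p ≠ f q) :
    T.card ≤ colorNum R P k := by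
  classical
  have hext : ∀ p : {x // x ∈ P}, (if h : (p : α) ∈ P then f ⟨p, h⟩ else 0) = f p :=
    fun p => dif_pos p.2
  rw [← Finset.card_map (Function.Embedding.subtype fun x => x ∈ P)]
  refine IsColoring.card_le_colorNum (f := fun x => if h : x ∈ P then f ⟨x, h⟩ else 0) ⟨?_, ?_⟩ ?_
  · intro x hx
    obtain ⟨p, hp, rfl⟩ := Finset.mem_map.1 hx
    exact (hext p).trans_lt (hf p hp)
  · intro x hx y hy hxy he
    obtain ⟨p, hp, rfl⟩ := Finset.mem_map.1 hx
    obtain ⟨q, hq, rfl⟩ := Finset.mem_map.1 hy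
    exact hR p hp q hq hxy ((hext p).symm.trans (he.trans (hext q)))
  · intro x hx
    obtain ⟨p, -, rfl⟩ := Finset.mem_map.1 hx
    exact p.2

theorem exists_coloring_card_eq (R : α → α → Prop) (P : Finset α) (k : ℕ) :
    ∃ S ⊆ P, ∃ f, IsColoring R S k f ∧ S.card = colorNum R P k := by
  classical
  have hne : (P.powerset.filter fun S => ∃ f, IsColoring R S k f).Nonempty :=
    ⟨∅, Finset.mem_filter.2 ⟨Finset.empty_mem_powerset _, fun _ => 0, by simp [IsColoring]⟩⟩
  obtain ⟨S, hS, h⟩ := Finset.exists_mem_eq_sup _ hne Finset.card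
  obtain ⟨hSP, f, hf⟩ := Finset.mem_filter.1 hS
  exact ⟨S, Finset.mem_powerset.1 hSP, f, hf, h.symm⟩

theorem IsColoring.subset {f : α → ℕ} (h : IsColoring R S k f) {T : Finset α} (hT : T ⊆ S) :
    IsColoring R T k f :=
  ⟨fun x hx => h.1 x (hT hx), fun x hx y hy => h.2 x (hT hx) y (hT hy)⟩

theorem colorNum_mono_right (h : k ≤ l) : colorNum R P k ≤ colorNum R P l := by
  obtain ⟨S, hS, f, hf, hc⟩ := exists_coloring_card_eq R P k
  rw [← hc]
  exact IsColoring.card_le_colorNum (f := f) ⟨fun x hx => (hf.1 x hx).trans_le h, hf.2⟩ hS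

theorem colorNum_mono_left (h : Q ⊆ P) : colorNum R Q k ≤ colorNum R P k := by
  obtain ⟨S, hS, f, hf, hc⟩ := exists_coloring_card_eq R Q k
  rw [← hc]
  exact hf.card_le_colorNum (hS.trans h)

theorem colorNum_le_card : colorNum R P k ≤ P.card := by
  obtain ⟨S, hS, f, hf, hc⟩ := exists_coloring_card_eq R P k
  rw [← hc]
  exact Finset.card_le_card hS

theorem colorNum_zero : colorNum R P 0 = 0 := by
  obtain ⟨S, hS, f, hf, hc⟩ := exists_coloring_card_eq R P 0
  rw [← hc, Finset.card_eq_zero, Finset.eq_empty_iff_forall_notMem]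
  exact fun x hx => absurd (hf.1 x hx) (Nat.not_lt_zero _)

theorem colorNum_eq_card (hR : ∀ x, ¬ R x x) (h : P.card ≤ k) : colorNum R P k = P.card := by
  refine le_antisymm colorNum_le_card ?_
  calc P.card = (Finset.univ : Finset {x // x ∈ P}).card := by simp
    _ ≤ _ := card_le_colorNum_of_subtype _ (fun p => (P.equivFin p : ℕ))
      (fun p _ => (P.equivFin p).2.trans_le h) fun p _ q _ hpq he =>
        hR p (by rwa [← P.equivFin.injective (Fin.ext he)] at hpq)

theorem colorNum_insert_le [DecidableEq α] (p : α) :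
    colorNum R (insert p P) k ≤ colorNum R P k + 1 := by
  obtain ⟨S, hS, f, hf, hc⟩ := exists_coloring_card_eq R (insert p P) k
  rw [← hc]
  have h1 : (S.erase p).card ≤ colorNum R P k :=
    (hf.subset (Finset.erase_subset _ _)).card_le_colorNum (Finset.subset_insert_iff.1 hS)
  have := Finset.pred_card_le_card_erase (s := S) (a := p)
  omega

/-- Adding an element unrelated to all others increases every number but the zeroth. -/
theorem colorNum_insert_of_unrelated [DecidableEq α] {p : α} (hp : p ∉ P)
    (hR : ∀ x ∈ insert p P, ¬ R x p ∧ ¬ R p x) :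
    colorNum R (insert p P) (k + 1) = colorNum R P (k + 1) + 1 := by
  refine le_antisymm (colorNum_insert_le p) ?_
  obtain ⟨S, hS, f, hf, hc⟩ := exists_coloring_card_eq R P (k + 1)
  rw [← hc, ← Finset.card_insert_of_notMem (fun h => hp (hS h))]
  have hne : ∀ x ∈ S, x ≠ p := fun x hx h => hp (h ▸ hS hx)
  refine IsColoring.card_le_colorNum (f := Function.update f p 0) ⟨?_, ?_⟩
    (Finset.insert_subset_insert _ hS)
  · intro x hx
    rcases Finset.mem_insert.1 hx with rfl | hx
    · simp
    · rw [Function.update_of_ne (hne x hx)]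
      exact hf.1 x hx
  · intro x hx y hy hxy
    rcases Finset.mem_insert.1 hx with rfl | hx'
    · exact absurd hxy (hR y (Finset.insert_subset_insert _ hS hy)).2
    rcases Finset.mem_insert.1 hy with rfl | hy'
    · exact absurd hxy (hR x (Finset.insert_subset_insert _ hS hx)).1
    rw [Function.update_of_ne (hne x hx'), Function.update_of_ne (hne y hy')]
    exact hf.2 x hx' y hy' hxy

/-- Only the symmetrisation of the relation matters. This allows incomparability in the plane to be
replaced by a transitive relation. -/
theorem colorNum_congr {R' : α → α → Prop} (h : ∀ x y, R x y ∨ R y x ↔ R' x y ∨ R' y x) :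
    colorNum R P k = colorNum R' P k := by
  have key : ∀ {R R' : α → α → Prop}, (∀ x y, R x y ∨ R y x ↔ R' x y ∨ R' y x) →
      colorNum R P k ≤ colorNum R' P k := by
    intro R R' h
    obtain ⟨S, hS, f, hf, hc⟩ := exists_coloring_card_eq R P k
    rw [← hc]
    refine IsColoring.card_le_colorNum (f := f) ⟨hf.1, fun x hx y hy hxy => ?_⟩ hS
    rcases (h x y).2 (Or.inl hxy) with h' | h'
    · exact hf.2 x hx y hy h'
    · exact (hf.2 y hy x hx h').symm
  exact le_antisymm (key h) (key fun x y => (h x y).symm)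

theorem sup_union_eq_colorNum (R : α → α → Prop) (P : Finset α) (k : ℕ)
    [DecidablePred fun S : Finset α => ∃ C : Fin k → Set α,
      (∀ t, ∀ x ∈ C t, ∀ y ∈ C t, ¬ R x y) ∧ (S : Set α) = ⋃ t, C t] :
    (P.powerset.filter fun S : Finset α => ∃ C : Fin k → Set α,
      (∀ t, ∀ x ∈ C t, ∀ y ∈ C t, ¬ R x y) ∧ (S : Set α) = ⋃ t, C t).sup Finset.card =
      colorNum R P k := by
  classical
  unfold colorNum
  congr 1
  ext S
  simp only [Finset.mem_filter, and_congr_right_iff]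
  intro _
  constructor
  · rintro ⟨C, hC, hS⟩
    have hx : ∀ x ∈ S, ∃ t, x ∈ C t := fun x hx => by
      have : x ∈ (S : Set α) := hx
      rw [hS] at this
      exact Set.mem_iUnion.1 this
    refine ⟨fun x => if h : x ∈ S then (hx x h).choose else 0, ?_, ?_⟩
    · intro x h
      simp [h]
    · intro x h y h' hxy he
      simp only [h, h', dite_true] at he
      have h2 := (hx y h').choose_spec
      rw [← Fin.ext he] at h2
      exact hC _ x (hx x h).choose_spec y h2 hxy
  · rintro ⟨f, hf⟩
    refine ⟨fun t => {x | x ∈ S ∧ f x = t}, ?_, ?_⟩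
    · rintro t x ⟨hx, hx'⟩ y ⟨hy, hy'⟩ hxy
      exact hf.2 x hx y hy hxy (hx'.trans hy'.symm)
    · ext x
      simp only [Set.mem_iUnion, Set.mem_ofPred_eq, Finset.mem_coe]
      exact ⟨fun h => ⟨⟨f x, hf.1 x h⟩, h, rfl⟩, fun ⟨_, h, _⟩ => h⟩

theorem chainNum_eq_colorNum [PartialOrder α] (P : Finset α) (k : ℕ) :
    chainNum P k = colorNum (fun x y => ¬ x ≤ y ∧ ¬ y ≤ x) P k := by
  classical
  rw [← sup_union_eq_colorNum]
  unfold chainNum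
  congr 1
  ext S
  simp only [Finset.mem_filter, and_congr_right_iff]
  intro _
  refine exists_congr fun C => and_congr_left fun _ => forall_congr' fun t => ?_
  constructor
  · rintro h x hx y hy ⟨h1, h2⟩
    exact (h.total hx hy).elim h1 h2
  · intro h x hx y hy _
    have := h x hx y hy
    by_cases h1 : x ≤ y
    · exact Or.inl h1
    · exact Or.inr (by_contra fun h2 => this ⟨h1, h2⟩)

theorem antichainNum_eq_colorNum [PartialOrder α] (P : Finset α) (k : ℕ) :
    antichainNum P k = colorNum (fun x y => x < y) P k := by
  classical
  rw [← sup_union_eq_colorNum]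
  unfold antichainNum
  congr 1
  ext S
  simp only [Finset.mem_filter, and_congr_right_iff]
  intro _
  refine exists_congr fun C => and_congr_left fun _ => forall_congr' fun t => ?_
  constructor
  · intro h x hx y hy hxy
    exact h hx hy hxy.ne hxy.le
  · intro h x hx y hy hne hle
    exact h x hx y hy (lt_of_le_of_ne hle hne)

end Coloring

/-! ### Labellings and exchange inequalities -/

section Labeling

variable {α : Type*}

/-- A `k`-labelling of `P` for the relation `R`: integers `lo x ≤ hi x ≤ lo x + 1` between `0`
and `k` with `hi x ≤ lo y` whenever `R x y`. -/
structure IsLabeling (R : α → α → Prop) (P : Finset α) (k : ℕ) (lo hi : α → ℤ) : Prop where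
  nonneg : ∀ x ∈ P, 0 ≤ lo x
  le : ∀ x ∈ P, lo x ≤ hi x
  le_add_one : ∀ x ∈ P, hi x ≤ lo x + 1
  le_top : ∀ x ∈ P, hi x ≤ k
  rel : ∀ x ∈ P, ∀ y ∈ P, R x y → hi x ≤ lo y

variable {R : α → α → Prop} {P Q S : Finset α} {k l : ℕ} {lo hi lo' hi' : α → ℤ}

/-- The elements where the label jumps are properly coloured by `lo`: if such an `x` is `R`-related
to `y`, then `lo x < hi x ≤ lo y`. -/
theorem IsLabeling.sum_le_colorNum (h : IsLabeling R P k lo hi) (hQ : Q ⊆ P) :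
    ∑ x ∈ Q, (hi x - lo x) ≤ colorNum R Q k := by
  classical
  have h1 : ∑ x ∈ Q, (hi x - lo x) = (Q.filter fun x => hi x = lo x + 1).card := by
    rw [Finset.card_filter, Nat.cast_sum]
    refine Finset.sum_congr rfl fun x hx => ?_
    have := h.le x (hQ hx)
    have := h.le_add_one x (hQ hx)
    split_ifs <;> push_cast <;> omega
  rw [h1]
  refine Nat.cast_le.2 (IsColoring.card_le_colorNum (f := fun x => (lo x).toNat) ⟨?_, ?_⟩
    (Finset.filter_subset _ _))
  · intro x hx
    obtain ⟨hx, he⟩ := Finset.mem_filter.1 hx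
    have := h.le_top x (hQ hx)
    have := h.nonneg x (hQ hx)
    dsimp only
    omega
  · intro x hx y hy hxy
    obtain ⟨hx, he⟩ := Finset.mem_filter.1 hx
    obtain ⟨hy, -⟩ := Finset.mem_filter.1 hy
    have := h.rel x (hQ hx) y (hQ hy) hxy
    have := h.nonneg x (hQ hx)
    dsimp only
    omega

/-- The largest `R`-clique of `S` lying `R`-below an element gives a labelling that jumps on `S`. -/
theorem IsColoring.exists_isLabeling (hirr : ∀ x, ¬ R x x)
    (htrans : ∀ x y z, R x y → R y z → R x z) {f : α → ℕ} (hf : IsColoring R S k f)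
    (P : Finset α) : ∃ lo hi, IsLabeling R P k lo hi ∧
      (∀ x ∈ S, hi x = lo x + 1) ∧ ∀ x ∉ S, hi x = lo x := by
  classical
  let cl : α → Finset (Finset α) := fun q => S.powerset.filter fun T =>
    (∀ x ∈ T, ∀ y ∈ T, x ≠ y → R x y ∨ R y x) ∧ ∀ x ∈ T, R x q
  let g : α → ℕ := fun q => (cl q).sup Finset.card
  have hne : ∀ q, (cl q).Nonempty := fun q => ⟨∅, by simp [cl]⟩
  have hex : ∀ q, ∃ T ⊆ S, (∀ x ∈ T, ∀ y ∈ T, x ≠ y → R x y ∨ R y x) ∧ (∀ x ∈ T, R x q) ∧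
      g q = T.card := fun q => by
    obtain ⟨T, hT, h⟩ := Finset.exists_mem_eq_sup _ (hne q) Finset.card
    obtain ⟨h1, h2, h3⟩ := Finset.mem_filter.1 hT
    exact ⟨T, Finset.mem_powerset.1 h1, h2, h3, h⟩
  have hle : ∀ q, ∀ T ⊆ S, (∀ x ∈ T, ∀ y ∈ T, x ≠ y → R x y ∨ R y x) → (∀ x ∈ T, R x q) →
      T.card ≤ g q := fun q T h1 h2 h3 =>
    Finset.le_sup (f := Finset.card) (Finset.mem_filter.2 ⟨Finset.mem_powerset.2 h1, h2, h3⟩)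
  -- A proper colouring is injective on a clique.
  have hbound : ∀ T ⊆ S, (∀ x ∈ T, ∀ y ∈ T, x ≠ y → R x y ∨ R y x) → T.card ≤ k := by
    intro T hTS hT
    rw [← Finset.card_range k]
    refine Finset.card_le_card_of_injOn f (fun x hx => ?_) fun x hx y hy hxy => ?_
    · simpa using hf.1 x (hTS hx)
    · by_contra hne
      rcases hT x hx y hy hne with h | h
      · exact hf.2 x (hTS hx) y (hTS hy) h hxy
      · exact hf.2 y (hTS hy) x (hTS hx) h hxy.symm
  -- For `q ∈ S` the clique counted by `g q` can be enlarged by `q` itself. So `g q + 1` is again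
  -- the size of a clique, which bounds `hi q` both by `k` and by `lo` of anything that `q` is
  -- related to.
  have hins : ∀ q ∈ S, ∃ T ⊆ S, (∀ x ∈ T, ∀ y ∈ T, x ≠ y → R x y ∨ R y x) ∧
      (∀ x ∈ T, x = q ∨ R x q) ∧ g q + 1 = T.card := fun q hq => by
    obtain ⟨T, hTS, hT, hTq, hc⟩ := hex q
    refine ⟨insert q T, Finset.insert_subset hq hTS, ?_, ?_, ?_⟩
    · intro x hx y hy hne
      rcases Finset.mem_insert.1 hx with hx | hx <;> rcases Finset.mem_insert.1 hy with hy | hy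
      · exact absurd (hx.trans hy.symm) hne
      · exact Or.inr (hx ▸ hTq y hy)
      · exact Or.inl (hy ▸ hTq x hx)
      · exact hT x hx y hy hne
    · intro x hx
      exact (Finset.mem_insert.1 hx).imp_right (hTq x)
    · rw [Finset.card_insert_of_notMem fun h => hirr q (hTq q h), hc]
  refine ⟨fun q => g q, fun q => g q + if q ∈ S then 1 else 0, ⟨?_, ?_, ?_, ?_, ?_⟩, ?_, ?_⟩
  · intro x _
    exact Nat.cast_nonneg _
  · intro x _
    split_ifs <;> omega
  · intro x _
    split_ifs <;> omega
  · intro x _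
    split_ifs with h
    · obtain ⟨T, hTS, hT, -, hc⟩ := hins x h
      have := hbound T hTS hT
      omega
    · obtain ⟨T, hTS, hT, -, hc⟩ := hex x
      have := hbound T hTS hT
      omega
  · intro x _ y _ hxy
    split_ifs with h
    · obtain ⟨T, hTS, hT, hTq, hc⟩ := hins x h
      have := hle y T hTS hT fun z hz => (hTq z hz).elim (fun h => h ▸ hxy)
        fun h => htrans _ _ _ h hxy
      omega
    · obtain ⟨T, hTS, hT, hTq, hc⟩ := hex x
      have := hle y T hTS hT fun z hz => htrans _ _ _ (hTq z hz) hxy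
      omega
  · intro x hx
    simp [hx]
  · intro x hx
    simp [hx]

theorem exists_isLabeling_sum_eq (hirr : ∀ x, ¬ R x x) (htrans : ∀ x y z, R x y → R y z → R x z)
    (P Q : Finset α) (k : ℕ) : ∃ lo hi, IsLabeling R P k lo hi ∧
      ∑ x ∈ Q, (hi x - lo x) = colorNum R Q k ∧ ∀ x ∉ Q, hi x = lo x := by
  classical
  obtain ⟨S, hS, f, hf, hc⟩ := exists_coloring_card_eq R Q k
  obtain ⟨lo, hi, h, h1, h2⟩ := hf.exists_isLabeling hirr htrans P
  refine ⟨lo, hi, h, ?_, fun x hx => h2 x fun h => hx (hS h)⟩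
  rw [← Finset.sum_subset hS fun x _ hx => by rw [h2 x hx, sub_self],
    Finset.sum_congr rfl fun x hx => show hi x - lo x = 1 by rw [h1 x hx]; ring]
  simp [hc]

theorem IsLabeling.mono (h : IsLabeling R P k lo hi) (hkl : k ≤ l) : IsLabeling R P l lo hi :=
  ⟨h.nonneg, h.le, h.le_add_one, fun x hx => (h.le_top x hx).trans (by exact_mod_cast hkl), h.rel⟩

theorem IsLabeling.sup (h : IsLabeling R P k lo hi) (h' : IsLabeling R P k lo' hi') :
    IsLabeling R P k (fun x => max (lo x) (lo' x)) fun x => max (hi x) (hi' x) where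
  nonneg x hx := le_max_of_le_left (h.nonneg x hx)
  le x hx := max_le_max (h.le x hx) (h'.le x hx)
  le_add_one x hx := by
    rw [← max_add_add_right]
    exact max_le_max (h.le_add_one x hx) (h'.le_add_one x hx)
  le_top x hx := max_le (h.le_top x hx) (h'.le_top x hx)
  rel x hx y hy hxy := max_le_max (h.rel x hx y hy hxy) (h'.rel x hx y hy hxy)

theorem IsLabeling.inf (h : IsLabeling R P k lo hi) (h' : IsLabeling R P l lo' hi') :
    IsLabeling R P l (fun x => min (lo x) (lo' x)) fun x => min (hi x) (hi' x) where
  nonneg x hx := le_min (h.nonneg x hx) (h'.nonneg x hx)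
  le x hx := min_le_min (h.le x hx) (h'.le x hx)
  le_add_one x hx := by
    rw [← min_add_add_right]
    exact min_le_min (h.le_add_one x hx) (h'.le_add_one x hx)
  le_top x hx := min_le_of_right_le (h'.le_top x hx)
  rel x hx y hy hxy := min_le_min (h.rel x hx y hy hxy) (h'.rel x hx y hy hxy)

/-- Modularity of the total jump, from `max a b + min a b = a + b`. Passing to the maximum and
minimum of two labellings therefore loses nothing. -/
theorem sum_max_add_sum_min (Q : Finset α) (lo hi lo' hi' : α → ℤ) :
    ∑ x ∈ Q, (max (hi x) (hi' x) - max (lo x) (lo' x)) +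
      ∑ x ∈ Q, (min (hi x) (hi' x) - min (lo x) (lo' x)) =
    ∑ x ∈ Q, (hi x - lo x) + ∑ x ∈ Q, (hi' x - lo' x) := by
  rw [← Finset.sum_add_distrib, ← Finset.sum_add_distrib]
  refine Finset.sum_congr rfl fun x _ => ?_
  have := max_add_min (hi x) (hi' x)
  have := max_add_min (lo x) (lo' x)
  omega

theorem IsLabeling.sum_add_sum_le_sum_max (h : IsLabeling R P k lo hi)
    (h' : IsLabeling R P l lo' hi') (hQ : Q ⊆ P) :
    ∑ x ∈ Q, (hi x - lo x) + ∑ x ∈ Q, (hi' x - lo' x) ≤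
      ∑ x ∈ Q, (max (hi x) (hi' x) - max (lo x) (lo' x)) + colorNum R Q l := by
  rw [← sum_max_add_sum_min]
  exact add_le_add_right ((h.inf h').sum_le_colorNum hQ) _

theorem IsLabeling.sum_add_sum_le_sum_min (h : IsLabeling R P k lo hi)
    (h' : IsLabeling R P k lo' hi') (hQ : Q ⊆ P) :
    ∑ x ∈ Q, (hi x - lo x) + ∑ x ∈ Q, (hi' x - lo' x) ≤
      ∑ x ∈ Q, (min (hi x) (hi' x) - min (lo x) (lo' x)) + colorNum R Q k := by
  rw [← sum_max_add_sum_min, add_comm]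
  exact add_le_add_right ((h.sup h').sum_le_colorNum hQ) _

/-- The label of an `R`-maximal element can be raised to the top. -/
theorem IsLabeling.raise [DecidableEq α] (h : IsLabeling R P k lo hi) {p : α}
    (hp : ∀ x ∈ P, ¬ R p x) :
    IsLabeling R P k (Function.update lo p (k - (hi p - lo p))) (Function.update hi p k) where
  nonneg x hx := by
    by_cases he : x = p
    · subst he
      have := h.nonneg x hx
      have := h.le_top x hx
      simp only [Function.update_self]
      omega
    · simpa [he] using h.nonneg x hx
  le x hx := by
    by_cases he : x = p
    · subst he
      have := h.le x hx
      simp only [Function.update_self]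
      omega
    · simpa [he] using h.le x hx
  le_add_one x hx := by
    by_cases he : x = p
    · subst he
      have := h.le_add_one x hx
      simp only [Function.update_self]
      omega
    · simpa [he] using h.le_add_one x hx
  le_top x hx := by
    by_cases he : x = p
    · subst he
      simp
    · simpa [he] using h.le_top x hx
  rel x hx y hy hxy := by
    have hxp : x ≠ p := fun he => hp y hy (he ▸ hxy)
    rw [Function.update_of_ne hxp]
    by_cases he : y = p
    · subst he
      have := h.rel x hx y hy hxy
      have := h.le_top y hy
      simp only [Function.update_self]
      omega
    · simpa [he] using h.rel x hx y hy hxy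

/-- The label of an `R`-minimal element can be lowered to the bottom. -/
theorem IsLabeling.lower [DecidableEq α] (h : IsLabeling R P k lo hi) {p : α}
    (hp : ∀ x ∈ P, ¬ R x p) :
    IsLabeling R P k (Function.update lo p 0) (Function.update hi p (hi p - lo p)) where
  nonneg x hx := by
    by_cases he : x = p
    · subst he
      simp
    · simpa [he] using h.nonneg x hx
  le x hx := by
    by_cases he : x = p
    · subst he
      simpa using h.le x hx
    · simpa [he] using h.le x hx
  le_add_one x hx := by
    by_cases he : x = p
    · subst he
      have := h.le_add_one x hx
      simp only [Function.update_self]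
      omega
    · simpa [he] using h.le_add_one x hx
  le_top x hx := by
    by_cases he : x = p
    · subst he
      have := h.le_top x hx
      have := h.nonneg x hx
      simp only [Function.update_self]
      omega
    · simpa [he] using h.le_top x hx
  rel x hx y hy hxy := by
    have hyp : y ≠ p := fun he => hp x hx (he ▸ hxy)
    rw [Function.update_of_ne hyp]
    by_cases he : x = p
    · subst he
      have := h.rel x hx y hy hxy
      have := h.nonneg x hx
      simp only [Function.update_self]
      omega
    · simpa [he] using h.rel x hx y hy hxy

variable [DecidableEq α] {p q : α}

theorem sum_sub_update_of_notMem {lo hi : α → ℤ} (hp : p ∉ Q) (a b : ℤ) :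
    ∑ x ∈ Q, (Function.update hi p a x - Function.update lo p b x) = ∑ x ∈ Q, (hi x - lo x) :=
  Finset.sum_congr rfl fun x hx => by
    rw [Function.update_of_ne (ne_of_mem_of_not_mem hx hp),
      Function.update_of_ne (ne_of_mem_of_not_mem hx hp)]

/-- Exchange of labellings when `p` is `R`-maximal and `q` is `R`-minimal. -/
theorem colorNum_exchange_of_max_min (hirr : ∀ x, ¬ R x x)
    (htrans : ∀ x y z, R x y → R y z → R x z) (hp : p ∉ Q) (hq : q ∉ Q) (hpq : p ≠ q)
    (hmax : ∀ x ∈ insert p (insert q Q), ¬ R p x) (hmin : ∀ x ∈ insert p (insert q Q), ¬ R x q)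
    (k : ℕ) :
    colorNum R (insert p Q) (k + 1) + colorNum R (insert q Q) k ≤
      colorNum R (insert p (insert q Q)) (k + 1) + colorNum R Q k := by
  obtain ⟨lo, hi, h, hs, h0⟩ := exists_isLabeling_sum_eq hirr htrans
    (insert p (insert q Q)) (insert p Q) (k + 1)
  obtain ⟨lo', hi', h', hs', h0'⟩ := exists_isLabeling_sum_eq hirr htrans
    (insert p (insert q Q)) (insert q Q) k
  -- At `p` the first labelling now ends at `k + 1`, above all values of the second, so the maximum
  -- keeps its jump there. At `q` the first is constantly `0`, so the maximum keeps the jump of the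
  -- second. The minimum is a `k`-labelling and is only needed on `Q`.
  have hm := (h.raise hmax).lower hmin
  have hm' := h'.lower hmin
  have h1 := (hm.sup (hm'.mono (Nat.le_succ k))).sum_le_colorNum subset_rfl
  have h2 := hm.sum_add_sum_le_sum_max hm'
    ((Finset.subset_insert q Q).trans (Finset.subset_insert p _))
  simp only [sum_sub_update_of_notMem hq, sum_sub_update_of_notMem hp] at h2
  have hpi : p ∉ insert q Q := by simp [hp, hpq]
  rw [Finset.sum_insert hp] at hs
  rw [Finset.sum_insert hq] at hs'
  rw [Finset.sum_insert hpi, Finset.sum_insert hq] at h1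
  have e1 := h0 q (by simp [hq, hpq.symm])
  have e2 := h0' p hpi
  have b1 := h.le p (by simp)
  have b2 := h.le_add_one p (by simp)
  have b3 := h'.le q (by simp)
  have b4 := h'.le_top p (by simp)
  simp only [Function.update_self, Function.update_of_ne hpq, Function.update_of_ne hpq.symm,
    e1, e2, sub_self, max_self] at h1 h2
  have m1 : max ((k + 1 : ℕ) : ℤ) (lo' p) = k + 1 := by
    rw [max_eq_left] <;> push_cast <;> omega
  have m2 : max (((k + 1 : ℕ) : ℤ) - (hi p - lo p)) (lo' p) = k + 1 - (hi p - lo p) := by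
    rw [max_eq_left] <;> push_cast <;> omega
  have m3 : max 0 (hi' q - lo' q) = hi' q - lo' q := max_eq_right (by omega)
  rw [m1, m2, m3] at h1
  zify
  push_cast at *
  linarith

/-- Exchange of labellings when `p` and `q` are both `R`-maximal. -/
theorem colorNum_exchange_of_max_max (hirr : ∀ x, ¬ R x x)
    (htrans : ∀ x y z, R x y → R y z → R x z) (hp : p ∉ Q) (hq : q ∉ Q) (hpq : p ≠ q)
    (hmax : ∀ x ∈ insert p (insert q Q), ¬ R p x) (hmax' : ∀ x ∈ insert p (insert q Q), ¬ R q x)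
    (k : ℕ) :
    colorNum R (insert p Q) k + colorNum R (insert q Q) k ≤
      colorNum R (insert p (insert q Q)) k + colorNum R Q k := by
  obtain ⟨lo, hi, h, hs, h0⟩ := exists_isLabeling_sum_eq hirr htrans
    (insert p (insert q Q)) (insert p Q) k
  obtain ⟨lo', hi', h', hs', h0'⟩ := exists_isLabeling_sum_eq hirr htrans
    (insert p (insert q Q)) (insert q Q) k
  -- At `p` the second labelling has no jump and is constantly `k` after raising, so the minimum
  -- keeps the jump of the first; the roles are exchanged at `q`. The maximum is only needed on `Q`.
  have hm := (h.raise hmax).raise hmax'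
  have hm' := (h'.raise hmax).raise hmax'
  have h1 := (hm.inf hm').sum_le_colorNum subset_rfl
  have h2 := hm.sum_add_sum_le_sum_min hm'
    ((Finset.subset_insert q Q).trans (Finset.subset_insert p _))
  simp only [sum_sub_update_of_notMem hq, sum_sub_update_of_notMem hp] at h2
  have hpi : p ∉ insert q Q := by simp [hp, hpq]
  rw [Finset.sum_insert hp] at hs
  rw [Finset.sum_insert hq] at hs'
  rw [Finset.sum_insert hpi, Finset.sum_insert hq] at h1
  have e1 := h0 q (by simp [hq, hpq.symm])
  have e2 := h0' p hpi
  have b1 := h.le p (by simp)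
  have b3 := h'.le q (by simp)
  simp only [Function.update_self, Function.update_of_ne hpq, Function.update_of_ne hpq.symm,
    e1, e2, sub_self, sub_zero, min_self] at h1 h2
  have m1 : min ((k : ℤ) - (hi p - lo p)) k = k - (hi p - lo p) := min_eq_left (by omega)
  have m2 : min (k : ℤ) (k - (hi' q - lo' q)) = k - (hi' q - lo' q) := min_eq_right (by omega)
  rw [m1, m2] at h1
  zify
  linarith

end Labeling

end Greene

/-! ### The assignment problem and Greene duality -/

namespace Greene

/-- Duality for the assignment problem with integral weights `w` and permitted pairs `R`. -/
theorem exists_perm_and_tight_dual {X : Type*} [Fintype X] (R : X → X → Prop) (hR : ∀ x, R x x)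
    (w : X → X → ℤ) : ∃ (τ : Equiv.Perm X) (u v : X → ℤ),
      (∀ x y, R x y → w x y ≤ u x + v y) ∧
      ∀ x, R x (τ x) ∧ w x (τ x) = u x + v (τ x) := by
  classical
  -- The total slack of a feasible dual pair along the identity is a nonnegative integer, since the
  -- identity is permitted; a pair with least slack is chosen.
  let D : ℕ → Prop := fun d => ∃ u v : X → ℤ, (∀ x y, R x y → w x y ≤ u x + v y) ∧
    ∑ x, (u x + v x - w x x) = d
  have hD : ∃ d, D d := by
    have hf : ∀ x y, R x y → w x y ≤ (∑ z, |w x z|) + 0 := fun x y _ => by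
      rw [add_zero]
      exact (le_abs_self _).trans
        (Finset.single_le_sum (f := fun z => |w x z|) (fun z _ => abs_nonneg _) (Finset.mem_univ y))
    refine ⟨_, fun x => ∑ z, |w x z|, fun _ => 0, hf, (Int.toNat_of_nonneg ?_).symm⟩
    exact Finset.sum_nonneg fun x _ => sub_nonneg.2 (hf x x (hR x))
  obtain ⟨u, v, huv, hd⟩ := Nat.find_spec hD
  let t : X → Finset X := fun x => Finset.univ.filter fun y => R x y ∧ w x y = u x + v y
  by_cases hall : ∀ s : Finset X, s.card ≤ (s.biUnion t).card
  · obtain ⟨f, hf, hft⟩ := (Finset.all_card_le_biUnion_card_iff_exists_injective t).1 hall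
    refine ⟨Equiv.ofBijective f hf.bijective_of_finite, u, v, huv, fun x => ?_⟩
    simpa [t] using hft x
  · exfalso
    push Not at hall
    obtain ⟨s, hs⟩ := hall
    -- A set `s` violating Hall's condition has too few tight neighbours. Lowering `u` by one on `s`
    -- and raising `v` by one on these neighbours preserves feasibility, because an integral
    -- constraint that is not tight has slack at least one; the total slack strictly drops.
    let u' : X → ℤ := fun x => u x - if x ∈ s then 1 else 0
    let v' : X → ℤ := fun x => v x + if x ∈ s.biUnion t then 1 else 0
    have hf : ∀ x y, R x y → w x y ≤ u' x + v' y := by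
      intro x y hxy
      have h1 := huv x y hxy
      simp only [u', v']
      by_cases hx : x ∈ s
      · by_cases hy : y ∈ s.biUnion t
        · simp only [hx, hy, if_true]
          omega
        · have : w x y ≠ u x + v y := fun he =>
            hy (Finset.mem_biUnion.2 ⟨x, hx, by simp [t, hxy, he]⟩)
          simp only [hx, hy, if_true, if_false]
          omega
      · simp only [hx, if_false]
        split_ifs <;> omega
    have hsum : ∑ x, (u' x + v' x - w x x) =
        ∑ x, (u x + v x - w x x) - s.card + (s.biUnion t).card := by
      have e1 : (s.card : ℤ) = ∑ x, if x ∈ s then 1 else 0 := by simp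
      have e2 : ((s.biUnion t).card : ℤ) = ∑ x, if x ∈ s.biUnion t then 1 else 0 := by
        rw [Finset.sum_ite_mem]
        simp
      rw [e1, e2, ← Finset.sum_sub_distrib, ← Finset.sum_add_distrib]
      refine Finset.sum_congr rfl fun x _ => ?_
      simp only [u', v']
      ring
    have hnn : 0 ≤ ∑ x, (u' x + v' x - w x x) :=
      Finset.sum_nonneg fun x _ => sub_nonneg.2 (hf x x (hR x))
    have hmin := Nat.find_min' hD ⟨u', v', hf, (Int.toNat_of_nonneg hnn).symm⟩
    omega

section Duality

variable {α : Type*} [PartialOrder α]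

/-- The elements moved by a permutation of `P ⊔ Fin N` that maps elements of `P` upwards or to
`Fin N` form a union of chains, one for each index that is mapped into `P`. -/
theorem card_moved_le_chainNum (P : Finset α) {N : ℕ}
    (τ : Equiv.Perm ({x // x ∈ P} ⊕ Fin N))
    (hτ : ∀ p q : {x // x ∈ P}, τ (Sum.inl p) = Sum.inl q → p ≤ q)
    [DecidablePred fun p : {x // x ∈ P} => τ (Sum.inl p) ≠ Sum.inl p]
    [DecidablePred fun i : Fin N => ∃ p, τ (Sum.inr i) = Sum.inl p] :
    (Finset.univ.filter fun p : {x // x ∈ P} => τ (Sum.inl p) ≠ Sum.inl p).card ≤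
      chainNum P (Finset.univ.filter fun i : Fin N => ∃ p, τ (Sum.inr i) = Sum.inl p).card := by
  classical
  rw [chainNum_eq_colorNum]
  set H := Finset.univ.filter fun i : Fin N => ∃ p, τ (Sum.inr i) = Sum.inl p with hH
  let r : {x // x ∈ P} → {x // x ∈ P} → Prop := fun p q => τ (Sum.inl p) = Sum.inl q
  have hr : Relator.RightUnique r := fun a b c hab hac => Sum.inl.inj (hab.symm.trans hac)
  have hle : ∀ p q, Relation.ReflTransGen r p q → p ≤ q := by
    intro p q h
    induction h with
    | refl => exact le_rfl
    | tail _ h ih => exact ih.trans (hτ _ _ h)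
  -- Going backwards along `τ` from a moved element meets only moved elements and strictly descends
  -- in `P`, so it must leave `P` through an index in `H`. Elements reached from the same index lie
  -- on one forward path of `τ`, hence are comparable.
  have hex : ∀ p : {x // x ∈ P}, τ (Sum.inl p) ≠ Sum.inl p →
      ∃ i ∈ H, ∃ s, τ (Sum.inr i) = Sum.inl s ∧ Relation.ReflTransGen r s p := by
    intro p
    induction p using WellFoundedLT.induction with
    | ind p ih =>
      intro hp
      obtain ⟨y, hy⟩ := τ.surjective (Sum.inl p)
      rcases y with q | i
      · have hqp : q ≠ p := fun h => hp (h ▸ hy)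
        obtain ⟨i, hi, s, hs, hsq⟩ := ih q (lt_of_le_of_ne (hτ q p hy) hqp) fun h =>
          hqp (Sum.inl.inj (h.symm.trans hy))
        exact ⟨i, hi, s, hs, hsq.tail hy⟩
      · exact ⟨i, by simp [hH, hy], p, hy, Relation.ReflTransGen.refl⟩
  choose c hcH s hs hsp using hex
  refine card_le_colorNum_of_subtype _
    (fun p => if h : τ (Sum.inl p) ≠ Sum.inl p then (H.equivFin ⟨c p h, hcH p h⟩ : ℕ) else 0) ?_ ?_
  · intro p hp
    rw [dif_pos (Finset.mem_filter.1 hp).2]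
    exact Fin.is_lt _
  · intro p hp q hq hpq he
    replace hp := (Finset.mem_filter.1 hp).2
    replace hq := (Finset.mem_filter.1 hq).2
    rw [dif_pos hp, dif_pos hq] at he
    have hc : c p hp = c q hq := by simpa using H.equivFin.injective (Fin.ext he)
    have hss : s p hp = s q hq := Sum.inl.inj ((hs p hp).symm.trans
      ((congrArg _ (congrArg _ hc)).trans (hs q hq)))
    rcases Relation.ReflTransGen.total_of_right_unique hr (hsp p hp) (hss ▸ hsp q hq) with h | h
    · exact hpq.1 (hle _ _ h)
    · exact hpq.2 (hle _ _ h)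

/-- At most `N` chains may be used, each at price `k`. Here `h` is the number of chains in an
optimal solution, and `K` is the additional price imposed by the cap `N`, which vanishes when the
cap is not reached. -/
theorem exists_chainNum_add_antichainNum_ge (P : Finset α) {N : ℕ} (hN : 0 < N) (k : ℕ) :
    ∃ h K : ℕ, h ≤ N ∧ (h < N → K = 0) ∧
      P.card + N * K + k * h ≤ chainNum P h + antichainNum P (k + K) := by
  classical
  let R : {x // x ∈ P} ⊕ Fin N → {x // x ∈ P} ⊕ Fin N → Prop := fun x y =>
    ∀ p q, x = Sum.inl p → y = Sum.inl q → p ≤ q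
  -- A moved element of `P` earns `1` and each passage from `Fin N` into `P`, the start of a chain,
  -- costs `k`.
  let w : {x // x ∈ P} ⊕ Fin N → {x // x ∈ P} ⊕ Fin N → ℤ := fun x y =>
    Sum.elim (fun p => if y = Sum.inl p then 0 else 1)
      (fun _ => Sum.elim (fun _ => -(k : ℤ)) (fun _ => 0) y) x
  obtain ⟨τ, u, v, huv, hτ⟩ := exists_perm_and_tight_dual R
    (fun x p q hp hq => (Sum.inl.inj (hp.symm.trans hq)).le) w
  have : Nonempty (Fin N) := ⟨⟨0, hN⟩⟩
  obtain ⟨i₀, hi₀⟩ := Finite.exists_min fun i : Fin N => u (Sum.inr i)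
  obtain ⟨j₀, hj₀⟩ := Finite.exists_min fun i : Fin N => v (Sum.inr i)
  have hK : 0 ≤ u (Sum.inr i₀) + v (Sum.inr j₀) := huv (Sum.inr i₀) (Sum.inr j₀) (by simp [R])
  obtain ⟨K, hK⟩ := Int.eq_ofNat_of_zero_le hK
  set S := Finset.univ.filter fun p : {x // x ∈ P} => τ (Sum.inl p) ≠ Sum.inl p with hS
  set H := Finset.univ.filter fun i : Fin N => ∃ p, τ (Sum.inr i) = Sum.inl p with hH
  have hSH : S.card ≤ chainNum P H.card :=
    card_moved_le_chainNum P τ fun p q h => (hτ (Sum.inl p)).1 p q rfl h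
  have hHN : H.card ≤ N := (Finset.card_le_univ _).trans_eq (Fintype.card_fin N)
  have hweight : ∑ x, w x (τ x) = S.card - k * H.card := by
    rw [Fintype.sum_sum_type, hS, hH, Finset.card_filter, Finset.card_filter, Nat.cast_sum,
      Nat.cast_sum, Finset.mul_sum, sub_eq_add_neg, ← Finset.sum_neg_distrib]
    congr 1
    · refine Finset.sum_congr rfl fun p _ => ?_
      simp only [w, Sum.elim_inl]
      split_ifs <;> simp_all
    · refine Finset.sum_congr rfl fun i _ => ?_
      simp only [w, Sum.elim_inr]
      rcases τ (Sum.inr i) with p | j <;> simp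
  have hdual : ∑ x, w x (τ x) = ∑ x, (u x + v x) := by
    rw [Finset.sum_congr rfl fun x _ => (hτ x).2, Finset.sum_add_distrib, Finset.sum_add_distrib,
      Equiv.sum_comp τ v]
  set Z := Finset.univ.filter fun p : {x // x ∈ P} => u (Sum.inl p) + v (Sum.inl p) = 0 with hZ
  have hww : ∀ p : {x // x ∈ P}, 0 ≤ u (Sum.inl p) + v (Sum.inl p) := fun p => by
    simpa [w] using huv (Sum.inl p) (Sum.inl p) (by
      rintro _ _ ⟨⟩ ⟨⟩
      exact le_rfl)
  have hZcard : Z.card ≤ antichainNum P (k + K) := by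
    rw [antichainNum_eq_colorNum]
    -- On `Z` one has `u = -v`. Feasibility against `i₀` and `j₀` puts the shifted potential `v`
    -- between `0` and `k + K - 1`, and for `p < q` the constraint of weight `1` gives `v q ≥ v p +
    -- 1`.
    refine card_le_colorNum_of_subtype _
      (fun p => (v (Sum.inl p) + k + u (Sum.inr i₀)).toNat) ?_ ?_
    · intro p hp
      replace hp := (Finset.mem_filter.1 hp).2
      have h1 : -(k : ℤ) ≤ _ := huv (Sum.inr i₀) (Sum.inl p) (by simp [R])
      have h2 : 1 ≤ u (Sum.inl p) + v (Sum.inr j₀) := by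
        simpa [w] using huv (Sum.inl p) (Sum.inr j₀) (by simp [R])
      omega
    · intro p hp q hq hpq
      replace hp := (Finset.mem_filter.1 hp).2
      replace hpq : p < q := hpq
      have h1 : -(k : ℤ) ≤ _ := huv (Sum.inr i₀) (Sum.inl p) (by simp [R])
      have h2 : -(k : ℤ) ≤ _ := huv (Sum.inr i₀) (Sum.inl q) (by simp [R])
      have h3 : 1 ≤ u (Sum.inl p) + v (Sum.inl q) := by
        simpa [w, hpq.ne'] using huv (Sum.inl p) (Sum.inl q) (by
          rintro _ _ ⟨⟩ ⟨⟩
          exact hpq.le)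
      omega
  have hsum : (P.card : ℤ) - Z.card + N * K ≤ ∑ x, (u x + v x) := by
    rw [Fintype.sum_sum_type]
    refine add_le_add ?_ ?_
    · have e1 : (P.card : ℤ) = ∑ _p : {x // x ∈ P}, (1 : ℤ) := by simp
      have e2 : (Z.card : ℤ) =
          ∑ p : {x // x ∈ P}, if u (Sum.inl p) + v (Sum.inl p) = 0 then 1 else 0 := by
        rw [hZ, Finset.card_filter]
        simp
      rw [e1, e2, ← Finset.sum_sub_distrib]
      refine Finset.sum_le_sum fun p _ => ?_
      have := hww p
      split_ifs <;> omega
    · have e1 : (N * K : ℤ) = ∑ _i : Fin N, (K : ℤ) := by simp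
      rw [e1]
      refine Finset.sum_le_sum fun i _ => ?_
      have := hi₀ i
      have := hj₀ i
      omega
  -- If `h < N`, some index is sent to an index. That pair is tight of weight `0`, which forces `K =
  -- 0`.
  refine ⟨H.card, K, hHN, fun hlt => ?_, ?_⟩
  · have hne : ∃ i, i ∉ H := by
      by_contra! hall
      rw [Finset.eq_univ_iff_forall.2 hall, Finset.card_univ, Fintype.card_fin] at hlt
      exact lt_irrefl _ hlt
    obtain ⟨i, hi⟩ := hne
    have h2 := (hτ (Sum.inr i)).2
    rcases hτi : τ (Sum.inr i) with p | j
    · exact absurd (by simp [hH, hτi]) hi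
    · rw [hτi] at h2
      have h3 : (0 : ℤ) = u (Sum.inr i) + v (Sum.inr j) := h2
      have := hi₀ i
      have := hj₀ j
      omega
  · zify at hSH hZcard ⊢
    linarith

/-- An element common to both unions is determined by its chain and its antichain, so at most `h *
k` elements are counted twice. -/
theorem chainNum_add_antichainNum_le (P : Finset α) (h k : ℕ) :
    chainNum P h + antichainNum P k ≤ P.card + h * k := by
  classical
  rw [chainNum_eq_colorNum, antichainNum_eq_colorNum]
  obtain ⟨S, hS, f, hf, hc⟩ := exists_coloring_card_eq (fun x y : α => ¬ x ≤ y ∧ ¬ y ≤ x) P h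
  obtain ⟨T, hT, g, hg, hc'⟩ := exists_coloring_card_eq (fun x y : α => x < y) P k
  rw [← hc, ← hc', ← Finset.card_union_add_card_inter]
  refine add_le_add (Finset.card_le_card (Finset.union_subset hS hT)) ?_
  rw [← Finset.card_range h, ← Finset.card_range k, ← Finset.card_product]
  refine Finset.card_le_card_of_injOn (fun x => (f x, g x)) (fun x hx => ?_) fun x hx y hy hxy => ?_
  · have hx := Finset.mem_inter.1 hx
    simpa using ⟨hf.1 x hx.1, hg.1 x hx.2⟩
  · have hx := Finset.mem_inter.1 hx
    have hy := Finset.mem_inter.1 hy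
    simp only [Prod.mk.injEq] at hxy
    have h1 : ¬ (¬ x ≤ y ∧ ¬ y ≤ x) := fun h => hf.2 x hx.1 y hy.1 h hxy.1
    have h2 : ¬ x < y := fun h => hg.2 x hx.2 y hy.2 h hxy.2
    have h3 : ¬ y < x := fun h => hg.2 y hy.2 x hx.2 h hxy.2.symm
    by_contra hne
    exact h1 ⟨fun h => h2 (lt_of_le_of_ne h hne), fun h => h3 (lt_of_le_of_ne h (Ne.symm hne))⟩

theorem chainNum_mono (P : Finset α) : Monotone (chainNum P) := fun k l h => by
  rw [chainNum_eq_colorNum, chainNum_eq_colorNum]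
  exact colorNum_mono_right h

theorem antichainNum_mono (P : Finset α) : Monotone (antichainNum P) := fun k l h => by
  rw [antichainNum_eq_colorNum, antichainNum_eq_colorNum]
  exact colorNum_mono_right h

theorem chainNum_zero (P : Finset α) : chainNum P 0 = 0 := by
  rw [chainNum_eq_colorNum, colorNum_zero]

theorem chainNum_le_card (P : Finset α) (k : ℕ) : chainNum P k ≤ P.card := by
  rw [chainNum_eq_colorNum]
  exact colorNum_le_card

theorem antichainNum_le_card (P : Finset α) (k : ℕ) : antichainNum P k ≤ P.card := by
  rw [antichainNum_eq_colorNum]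
  exact colorNum_le_card

theorem chainNum_eq_card {P : Finset α} {k : ℕ} (h : P.card ≤ k) : chainNum P k = P.card := by
  rw [chainNum_eq_colorNum, colorNum_eq_card (fun x h => h.1 le_rfl) h]

theorem antichainNum_eq_card {P : Finset α} {k : ℕ} (h : P.card ≤ k) :
    antichainNum P k = P.card := by
  rw [antichainNum_eq_colorNum, colorNum_eq_card (fun x => lt_irrefl x) h]

/-- With price `0` and cap `h`, the price of the cap is the required `k`. -/
theorem exists_antichainNum_dual (P : Finset α) (h : ℕ) :
    ∃ k, chainNum P h + antichainNum P k = P.card + h * k := by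
  rcases Nat.eq_zero_or_pos h with rfl | hh
  · exact ⟨P.card, by rw [chainNum_zero, antichainNum_eq_card le_rfl]; omega⟩
  · obtain ⟨h', K, hle, -, hge⟩ := exists_chainNum_add_antichainNum_ge P hh 0
    refine ⟨K, le_antisymm (chainNum_add_antichainNum_le P h K) ?_⟩
    have := chainNum_mono P hle
    simp only [zero_mul, zero_add, add_zero] at hge
    omega

/-- A cap of `|P| + 1` has price `0`: otherwise the left side of the duality inequality would exceed
`2 |P|`. -/
theorem exists_chainNum_dual (P : Finset α) (k : ℕ) :
    ∃ h, chainNum P h + antichainNum P k = P.card + h * k := by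
  obtain ⟨h, K, hle, hlt, hge⟩ :=
    exists_chainNum_add_antichainNum_ge P (Nat.succ_pos P.card) k
  have hK : K = 0 := by
    rcases hle.lt_or_eq with h' | rfl
    · exact hlt h'
    · by_contra hK
      have h1 := chainNum_le_card P P.card.succ
      have h2 := antichainNum_le_card P (k + K)
      have h3 : P.card.succ * 1 ≤ P.card.succ * K := Nat.mul_le_mul_left _ (by omega)
      omega
  subst hK
  refine ⟨h, le_antisymm (chainNum_add_antichainNum_le P h k) ?_⟩
  rw [mul_comm h k]
  simpa using hge

end Duality

end Greene

namespace Greene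

/-! ### Concavity and existence of the shape -/

section Shape

variable {α : Type*} [PartialOrder α]

/-- For every `l` the affine function `k ↦ |P| + k l - a_l` bounds `c_k` from above, and some `l`
gives equality at `k + 1`. -/
theorem chainNum_concave (P : Finset α) (k : ℕ) :
    chainNum P k + chainNum P (k + 2) ≤ 2 * chainNum P (k + 1) := by
  obtain ⟨l, hl⟩ := exists_antichainNum_dual P (k + 1)
  have h1 := chainNum_add_antichainNum_le P k l
  have h2 := chainNum_add_antichainNum_le P (k + 2) l
  have e1 : (k + 1) * l = k * l + l := by ring
  have e2 : (k + 2) * l = k * l + 2 * l := by ring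
  omega

/-- The row lengths of the shape of `P`. -/
noncomputable def rowDiff (P : Finset α) (k : ℕ) : ℕ := chainNum P (k + 1) - chainNum P k

theorem chainNum_succ (P : Finset α) (k : ℕ) :
    chainNum P (k + 1) = chainNum P k + rowDiff P k :=
  (Nat.add_sub_cancel' (chainNum_mono P (Nat.le_succ k))).symm

theorem rowDiff_antitone (P : Finset α) : Antitone (rowDiff P) := by
  refine antitone_nat_of_succ_le fun k => ?_
  have h1 := chainNum_concave P k
  have h2 := chainNum_succ P k
  have h3 : chainNum P (k + 2) = _ := chainNum_succ P (k + 1)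
  omega

/-- Chain and antichain numbers are complementary at the outer corners of the shape. -/
theorem chainNum_add_antichainNum_eq {P : Finset α} {k l : ℕ} (hk : rowDiff P k ≤ l)
    (hl : ∀ i < k, l ≤ rowDiff P i) :
    chainNum P k + antichainNum P l = P.card + k * l := by
  refine le_antisymm (chainNum_add_antichainNum_le P k l) ?_
  obtain ⟨h, hh⟩ := exists_chainNum_dual P l
  -- The claim is that `c_h - h l` is largest at `h = k`. Its increments `rowDiff P h - l` are
  -- nonnegative before `k` and nonpositive from `k` on.
  suffices chainNum P h + k * l ≤ chainNum P k + h * l by omega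
  rcases le_total k h with hkh | hkh
  · obtain ⟨d, rfl⟩ := Nat.exists_eq_add_of_le hkh
    clear hh hkh
    induction d with
    | zero => rfl
    | succ d ih =>
      have h1 : chainNum P (k + (d + 1)) = _ := chainNum_succ P (k + d)
      have h2 := rowDiff_antitone P (Nat.le_add_right k d)
      have e : (k + (d + 1)) * l = (k + d) * l + l := by ring
      omega
  · clear hh hk
    induction k, hkh using Nat.le_induction with
    | base => rfl
    | succ k hk' ih =>
      have h1 := chainNum_succ P k
      have h2 := hl k (Nat.lt_succ_self k)
      have e : (k + 1) * l = k * l + l := by ring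
      have := ih fun i hi => hl i (by omega)
      omega

/-- The first row of length at most `l` serves. The bound `h ≤ k` ensures that a box added to row
`k` does not affect `c_h`. -/
theorem exists_le_chainNum_dual {P : Finset α} {k l : ℕ} (hk : rowDiff P k ≤ l) :
    ∃ h ≤ k, chainNum P h + antichainNum P l = P.card + h * l := by
  classical
  have hex : ∃ h, rowDiff P h ≤ l := ⟨k, hk⟩
  exact ⟨Nat.find hex, Nat.find_min' hex hk, chainNum_add_antichainNum_eq (Nat.find_spec hex)
    fun i hi => (not_le.1 (Nat.find_min hex hi)).le⟩

theorem rowDiff_eq_zero {P : Finset α} {k : ℕ} (hk : P.card ≤ k) : rowDiff P k = 0 := by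
  rw [rowDiff, chainNum_eq_card hk, chainNum_eq_card (hk.trans (Nat.le_succ k)), Nat.sub_self]

/-- Greene's duality theorem. -/
theorem exists_isShape (P : Finset α) : ∃ μ : YoungDiagram, IsShape P μ := by
  let μ : YoungDiagram :=
    { cells := (Finset.range P.card ×ˢ Finset.range P.card).filter fun x => x.2 < rowDiff P x.1
      isLowerSet := by
        rintro ⟨i, j⟩ ⟨i', j'⟩ hle h
        simp only [Finset.coe_filter, Finset.mem_product, Finset.mem_range,
          Set.mem_ofPred_eq] at h ⊢
        obtain ⟨h1, h2⟩ : i' ≤ i ∧ j' ≤ j := hle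
        have := rowDiff_antitone P h1
        omega }
  have hmem : ∀ i j, (i, j) ∈ μ ↔ j < rowDiff P i := by
    intro i j
    rw [← YoungDiagram.mem_cells]
    simp only [μ, Finset.mem_filter, Finset.mem_product, Finset.mem_range, and_iff_right_iff_imp]
    intro h
    have h1 : rowDiff P i ≤ P.card := (Nat.sub_le _ _).trans (chainNum_le_card P _)
    refine ⟨?_, by omega⟩
    by_contra hi
    rw [rowDiff_eq_zero (not_lt.1 hi)] at h
    omega
  refine ⟨μ, fun k => ?_, fun k => ?_⟩
  · refine eq_of_forall_lt_iff fun j => ?_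
    rw [← YoungDiagram.mem_iff_lt_rowLen, hmem, rowDiff]
  · have hcol : ∀ i, i < μ.colLen k ↔ k < rowDiff P i := fun i => by
      rw [← YoungDiagram.mem_iff_lt_colLen, hmem]
    -- The number of rows longer than `k` is a dual index for both `k` and `k + 1`; subtracting the
    -- two equalities gives the column length.
    have h0 : rowDiff P (μ.colLen k) ≤ k := not_lt.1 fun h => lt_irrefl _ ((hcol _).2 h)
    have h1 := chainNum_add_antichainNum_eq h0 fun i hi => ((hcol i).1 hi).le
    have h2 := chainNum_add_antichainNum_eq (h0.trans (Nat.le_succ k)) fun i hi => (hcol i).1 hi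
    have e : μ.colLen k * (k + 1) = μ.colLen k * k + μ.colLen k := by ring
    have h3 := antichainNum_mono P (Nat.le_succ k)
    simp only [Nat.succ_eq_add_one] at h2 h3
    omega

theorem isShape_shape (P : Finset α) : IsShape P (shape P) := by
  have h := exists_isShape P
  rw [shape, dif_pos h]
  exact h.choose_spec

theorem rowLen_shape (P : Finset α) (k : ℕ) : (shape P).rowLen k = rowDiff P k :=
  (isShape_shape P).1 k

end Shape

/-! ### Young diagrams by row lengths -/

section YoungDiagram

theorem youngDiagram_ext_rowLen {μ ν : YoungDiagram} (h : ∀ k, μ.rowLen k = ν.rowLen k) :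
    μ = ν := by
  refine SetLike.ext fun x => ?_
  obtain ⟨i, j⟩ := x
  rw [YoungDiagram.mem_iff_lt_rowLen, YoungDiagram.mem_iff_lt_rowLen, h]

theorem addsBox_of_rowLen {μ ν : YoungDiagram} {r : ℕ}
    (h : ∀ k, ν.rowLen k = μ.rowLen k + if k = r then 1 else 0) :
    AddsBox μ (r, μ.rowLen r) ν := by
  refine ⟨fun hm => lt_irrefl _ (YoungDiagram.mem_iff_lt_rowLen.1 hm), ?_⟩
  ext ⟨i, j⟩
  rw [Finset.mem_insert, YoungDiagram.mem_cells, YoungDiagram.mem_cells,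
    YoungDiagram.mem_iff_lt_rowLen, YoungDiagram.mem_iff_lt_rowLen, h, Prod.mk.injEq]
  split_ifs with hi
  · subst hi
    omega
  · omega

theorem AddsBox.rowLen_eq {μ ν : YoungDiagram} {b : ℕ × ℕ} (h : AddsBox μ b ν) (k : ℕ) :
    ν.rowLen k = μ.rowLen k + if k = b.1 then 1 else 0 := by
  obtain ⟨r, c⟩ := b
  obtain ⟨hb, hν⟩ := h
  have hrow : ν.row k = if k = r then insert (r, c) (μ.row k) else μ.row k := by
    rw [YoungDiagram.row, YoungDiagram.row, hν, Finset.filter_insert]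
    simp only [eq_comm]
  rw [YoungDiagram.rowLen_eq_card, YoungDiagram.rowLen_eq_card, hrow]
  dsimp only
  split_ifs
  · refine Finset.card_insert_of_notMem fun hm => hb (YoungDiagram.mem_row_iff.1 hm).1
  · rfl

theorem AddsBox.row_eq {μ ν : YoungDiagram} {b b' : ℕ × ℕ} (h : AddsBox μ b ν)
    (h' : AddsBox μ b' ν) : b.1 = b'.1 := by
  have h1 := h.rowLen_eq b.1
  have h2 := h'.rowLen_eq b.1
  by_contra hne
  rw [if_pos rfl] at h1
  rw [if_neg hne] at h2
  omega

theorem AddsBox.eq_of_row_eq {μ ν ν' : YoungDiagram} {b b' : ℕ × ℕ} (h : AddsBox μ b ν)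
    (h' : AddsBox μ b' ν') (hb : b.1 = b'.1) : ν = ν' :=
  youngDiagram_ext_rowLen fun k => by rw [h.rowLen_eq, h'.rowLen_eq, hb]

end YoungDiagram

/-! ### Adding one and two boxes -/

section Bump

variable {α : Type*} [PartialOrder α]

/-- The shape of `P` arises from the shape of `Q` by adding a box to row `r`. -/
def Bump (Q P : Finset α) (r : ℕ) : Prop :=
  ∀ k, chainNum P k = chainNum Q k + if r < k then 1 else 0

variable {Q P P₁ P₂ : Finset α} {r s : ℕ}

theorem Bump.rowDiff_eq (h : Bump Q P r) (k : ℕ) :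
    rowDiff P k = rowDiff Q k + if k = r then 1 else 0 := by
  have h1 := h k
  have h2 := h (k + 1)
  have h3 := chainNum_succ P k
  have h4 := chainNum_succ Q k
  split_ifs at * <;> omega

theorem Bump.rowLen_eq (h : Bump Q P r) (k : ℕ) :
    (shape P).rowLen k = (shape Q).rowLen k + if k = r then 1 else 0 := by
  rw [rowLen_shape, rowLen_shape, h.rowDiff_eq]

theorem Bump.addsBox (h : Bump Q P r) : AddsBox (shape Q) (r, (shape Q).rowLen r) (shape P) :=
  addsBox_of_rowLen h.rowLen_eq

theorem Bump.rowDiff_lt (h : Bump Q P r) {i : ℕ} (hi : i < r) : rowDiff Q r < rowDiff Q i := by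
  have h1 := rowDiff_antitone P hi.le
  rw [h.rowDiff_eq, h.rowDiff_eq, if_pos rfl, if_neg hi.ne] at h1
  omega

/-- A dual index `h ≤ r` for `l` in `P` has the same `c_h` in `Q`. Since `P` has one more element,
`c_h + a_k ≤ |Q| + h k` in `Q` forces `a_l` to grow. -/
theorem Bump.antichainNum_lt (h : Bump Q P r) (hc : P.card = Q.card + 1) {l : ℕ}
    (hl : rowDiff Q r < l) : antichainNum Q l < antichainNum P l := by
  obtain ⟨k, hk, hd⟩ := exists_le_chainNum_dual (P := P) (k := r) (l := l)
    (by rw [h.rowDiff_eq, if_pos rfl]; exact hl)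
  rw [h k, if_neg hk.not_gt, hc] at hd
  have := chainNum_add_antichainNum_le Q k l
  omega

/-- The chain numbers after two bumps, from the exchange inequalities. -/
theorem chainNum_of_bump_of_bump (h₁ : Bump Q P₁ r) (h₂ : Bump Q P₂ s) (hrs : r ≤ s)
    (hc₁ : P₁.card = Q.card + 1) (hc₂ : P₂.card = Q.card + 1) (hc : P.card = Q.card + 2)
    (hle : ∀ k, chainNum P₁ k ≤ chainNum P k) (hge₁ : ∀ k, chainNum P k ≤ chainNum P₁ k + 1)
    (hge : ∀ k, chainNum P k ≤ chainNum P₂ k + 1)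
    (hchain : ∀ k, chainNum P₁ k + chainNum P₂ (k + 1) ≤ chainNum P (k + 1) + chainNum Q k)
    (hanti : ∀ l, antichainNum P₁ l + antichainNum P₂ l ≤ antichainNum P l + antichainNum Q l)
    (k : ℕ) :
    chainNum P k =
      chainNum Q k + (if r < k then 1 else 0) +
        if (if r = s then r + 1 else s) < k then 1 else 0 := by
  -- Each new point alone raises `a_l`, and the exchange inequality adds up the two increases.
  have hanti2 : ∀ l, rowDiff Q r < l → antichainNum Q l + 2 ≤ antichainNum P l := fun l hl => by
    have e1 := h₁.antichainNum_lt hc₁ hl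
    have e2 := h₂.antichainNum_lt hc₂ ((rowDiff_antitone Q hrs).trans_lt hl)
    have := hanti l
    omega
  rcases Nat.lt_or_ge r k with hrk | hkr
  · have hlow := hle k
    have hup := hge₁ k
    rw [h₁ k, if_pos hrk] at hlow hup
    rw [if_pos hrk]
    by_cases ht : (if r = s then r + 1 else s) < k
    · rw [if_pos ht]
      -- Beyond both boxes the chain exchange gives the lower bound. The shift of index in it is why
      -- `r < m` is needed, and it holds even when `r = s`.
      obtain ⟨m, rfl⟩ : ∃ m, k = m + 1 := ⟨k - 1, by omega⟩
      have h := hchain m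
      have hm : r < m ∧ s < m + 1 := by split_ifs at ht <;> omega
      rw [h₁ m, h₂ (m + 1), if_pos hm.1, if_pos hm.2] at h
      omega
    · rw [if_neg ht]
      by_cases he : r = s
      · rw [if_pos he] at ht
        obtain rfl : k = r + 1 := by omega
        -- Two boxes in row `r` are excluded: with `l` one more than the length of that row in `Q`,
        -- `a_l` grows by two, and conjugacy leaves room for an increase of only one in `c_{r+1}`.
        have d1 := chainNum_add_antichainNum_eq (P := Q) (k := r) (l := rowDiff Q r + 1)
          (Nat.le_succ _) fun i hi => h₁.rowDiff_lt hi
        have d2 := chainNum_add_antichainNum_le P (r + 1) (rowDiff Q r + 1)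
        have d3 := hanti2 (rowDiff Q r + 1) (Nat.lt_succ_self _)
        have d4 := chainNum_succ Q r
        have e : (r + 1) * (rowDiff Q r + 1) = r * (rowDiff Q r + 1) + (rowDiff Q r + 1) := by ring
        omega
      · rw [if_neg he] at ht
        have h := hge k
        rw [h₂ k, if_neg ht] at h
        omega
  · have ht : ¬ (if r = s then r + 1 else s) < k := by split_ifs <;> omega
    rw [if_neg hkr.not_gt, if_neg ht]
    have hlow := hle k
    rw [h₁ k, if_neg hkr.not_gt] at hlow
    rcases Nat.eq_zero_or_pos k with rfl | hk
    · simp [chainNum_zero]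
    · obtain ⟨m, rfl⟩ : ∃ m, k = m + 1 := ⟨k - 1, by omega⟩
      -- Above row `r` nothing changes: for `l` the length of row `m`, `a_l` already absorbs both
      -- new elements.
      have d1 := chainNum_add_antichainNum_eq (P := Q) (k := m + 1) (l := rowDiff Q m)
        (rowDiff_antitone Q (Nat.le_succ m)) fun i hi =>
          rowDiff_antitone Q (Nat.lt_succ_iff.1 hi)
      have d2 := chainNum_add_antichainNum_le P (m + 1) (rowDiff Q m)
      have d3 := hanti2 (rowDiff Q m) (h₁.rowDiff_lt hkr)
      omega

end Bump

end Greene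

namespace Greene

/-! ### New points in the plane -/

section Plane

/-- Incomparability in the product order of the plane, directed to the southeast. -/
def Southeast (x y : ℕ × ℕ) : Prop := x.1 < y.1 ∧ y.2 < x.2

theorem chainNum_eq_colorNum_southeast (P : Finset (ℕ × ℕ)) (k : ℕ) :
    chainNum P k = colorNum Southeast P k := by
  rw [chainNum_eq_colorNum]
  refine colorNum_congr fun x y => ?_
  simp only [Southeast, Prod.le_def]
  omega

/-- Reversal interchanges the maximal and the minimal new point, so that one exchange lemma yields
both chain inequalities. -/
theorem chainNum_eq_colorNum_northwest (P : Finset (ℕ × ℕ)) (k : ℕ) :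
    chainNum P k = colorNum (fun x y => Southeast y x) P k := by
  rw [chainNum_eq_colorNum_southeast]
  exact colorNum_congr fun x y => or_comm

variable {Q : Finset (ℕ × ℕ)} {a b x y : ℕ}

/-- Two new points, one in a new last column and one in a new last row. -/
theorem chainNum_insert_insert (hQ : ∀ q ∈ Q, q.1 < a ∧ q.2 < b) (hx : x < a) (hy : y < b)
    {r s : ℕ} (h₁ : Bump Q (insert (a, y) Q) r) (h₂ : Bump Q (insert (x, b) Q) s) :
    Bump (insert (a, y) Q) (insert (a, y) (insert (x, b) Q)) (if r = s then r + 1 else s) ∧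
      Bump (insert (x, b) Q) (insert (a, y) (insert (x, b) Q)) (if r = s then r + 1 else r) := by
  have hp : (a, y) ∉ Q := fun h => lt_irrefl _ (hQ _ h).1
  have hq : (x, b) ∉ Q := fun h => lt_irrefl _ (hQ _ h).2
  have hpq : (a, y) ≠ (x, b) := fun h => hx.ne' (congrArg Prod.fst h)
  have hpi : (a, y) ∉ insert (x, b) Q := by simp [hp, hx.ne']
  have hbound : ∀ z ∈ insert (a, y) (insert (x, b) Q), z.1 ≤ a ∧ z.2 ≤ b := by
    intro z hz
    simp only [Finset.mem_insert] at hz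
    rcases hz with rfl | rfl | hz
    · exact ⟨le_rfl, hy.le⟩
    · exact ⟨hx.le, le_rfl⟩
    · exact ⟨(hQ z hz).1.le, (hQ z hz).2.le⟩
  have hmax : ∀ z ∈ insert (a, y) (insert (x, b) Q), ¬ Southeast (a, y) z := fun z hz h =>
    absurd (hbound z hz).1 (not_le.2 h.1)
  have hmin : ∀ z ∈ insert (a, y) (insert (x, b) Q), ¬ Southeast z (x, b) := fun z hz h =>
    absurd (hbound z hz).2 (not_le.2 h.2)
  have hirr : ∀ z, ¬ Southeast z z := fun z h => lt_irrefl _ h.1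
  have htrans : ∀ u v w, Southeast u v → Southeast v w → Southeast u w := fun u v w h h' =>
    ⟨h.1.trans h'.1, h'.2.trans h.2⟩
  have hc₁ : (insert (a, y) Q).card = Q.card + 1 := Finset.card_insert_of_notMem hp
  have hc₂ : (insert (x, b) Q).card = Q.card + 1 := Finset.card_insert_of_notMem hq
  have hc : (insert (a, y) (insert (x, b) Q)).card = Q.card + 2 := by
    rw [Finset.card_insert_of_notMem hpi, hc₂]
  have hcomm : insert (a, y) (insert (x, b) Q) = insert (x, b) (insert (a, y) Q) :=
    Finset.insert_comm _ _ _
  have hle₁ : ∀ k, chainNum (insert (a, y) Q) k ≤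
      chainNum (insert (a, y) (insert (x, b) Q)) k := fun k => by
    rw [chainNum_eq_colorNum, chainNum_eq_colorNum, hcomm]
    exact colorNum_mono_left (Finset.subset_insert _ _)
  have hle₂ : ∀ k, chainNum (insert (x, b) Q) k ≤
      chainNum (insert (a, y) (insert (x, b) Q)) k := fun k => by
    rw [chainNum_eq_colorNum, chainNum_eq_colorNum]
    exact colorNum_mono_left (Finset.subset_insert _ _)
  have hge₁ : ∀ k, chainNum (insert (a, y) (insert (x, b) Q)) k ≤
      chainNum (insert (a, y) Q) k + 1 := fun k => by
    rw [chainNum_eq_colorNum, chainNum_eq_colorNum, hcomm]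
    exact colorNum_insert_le _
  have hge₂ : ∀ k, chainNum (insert (a, y) (insert (x, b) Q)) k ≤
      chainNum (insert (x, b) Q) k + 1 := fun k => by
    rw [chainNum_eq_colorNum, chainNum_eq_colorNum]
    exact colorNum_insert_le _
  have hch₁ : ∀ k, chainNum (insert (a, y) Q) (k + 1) + chainNum (insert (x, b) Q) k ≤
      chainNum (insert (a, y) (insert (x, b) Q)) (k + 1) + chainNum Q k := fun k => by
    simp only [chainNum_eq_colorNum_southeast]
    exact colorNum_exchange_of_max_min hirr htrans hp hq hpq hmax hmin k
  have hch₂ : ∀ k, chainNum (insert (a, y) Q) k + chainNum (insert (x, b) Q) (k + 1) ≤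
      chainNum (insert (a, y) (insert (x, b) Q)) (k + 1) + chainNum Q k := fun k => by
    simp only [chainNum_eq_colorNum_northwest]
    rw [add_comm, hcomm]
    rw [hcomm] at hmax hmin
    exact colorNum_exchange_of_max_min (R := fun x y => Southeast y x) hirr
      (fun u v w h h' => htrans w v u h' h) hq hp hpq.symm hmin hmax k
  have hanti : ∀ l, antichainNum (insert (a, y) Q) l + antichainNum (insert (x, b) Q) l ≤
      antichainNum (insert (a, y) (insert (x, b) Q)) l + antichainNum Q l := fun l => by
    simp only [antichainNum_eq_colorNum]
    refine colorNum_exchange_of_max_max (fun z => lt_irrefl z) (fun u v w => lt_trans) hp hq hpq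
      (fun z hz h => ?_) (fun z hz h => ?_) l
    · simp only [Finset.mem_insert] at hz
      have h1 : a ≤ z.1 := h.le.1
      rcases hz with rfl | rfl | hz
      · exact lt_irrefl _ h
      · exact absurd h1 (not_le.2 hx)
      · exact absurd h1 (not_le.2 (hQ z hz).1)
    · simp only [Finset.mem_insert] at hz
      have h1 : b ≤ z.2 := h.le.2
      rcases hz with rfl | rfl | hz
      · exact absurd h1 (not_le.2 hy)
      · exact lt_irrefl _ h
      · exact absurd h1 (not_le.2 (hQ z hz).2)
  have key : ∀ k, chainNum (insert (a, y) (insert (x, b) Q)) k = chainNum Q k +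
      (if r < k then 1 else 0) + if (if r = s then r + 1 else s) < k then 1 else 0 := by
    rcases le_total r s with hrs | hsr
    · exact chainNum_of_bump_of_bump h₁ h₂ hrs hc₁ hc₂ hc hle₁ hge₁ hge₂ hch₂ hanti
    · intro k
      rw [chainNum_of_bump_of_bump h₂ h₁ hsr hc₂ hc₁ hc hle₂ hge₂ hge₁
        (fun k => by rw [add_comm]; exact hch₁ k) (fun l => by rw [add_comm]; exact hanti l) k]
      by_cases he : r = s
      · subst he
        rfl
      · rw [if_neg he, if_neg (Ne.symm he)]
        omega
  refine ⟨fun k => by rw [key, h₁ k], fun k => ?_⟩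
  rw [key, h₂ k]
  by_cases he : r = s
  · subst he
    rfl
  · rw [if_neg he, if_neg he]
    omega

/-- A new maximum adds a box to the first row. -/
theorem bump_insert_max (hQ : ∀ q ∈ Q, q.1 < a ∧ q.2 < b) : Bump Q (insert (a, b) Q) 0 := by
  have hp : (a, b) ∉ Q := fun h => lt_irrefl _ (hQ _ h).1
  intro k
  rcases k with _ | k
  · simp [chainNum_zero]
  · rw [if_pos (Nat.succ_pos k), chainNum_eq_colorNum, chainNum_eq_colorNum,
      colorNum_insert_of_unrelated hp]
    intro z hz
    have hle : z ≤ (a, b) := by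
      rcases Finset.mem_insert.1 hz with rfl | hz
      · exact le_rfl
      · exact ⟨(hQ z hz).1.le, (hQ z hz).2.le⟩
    exact ⟨fun h => h.1 hle, fun h => h.2 hle⟩

end Plane

/-! ### Growth diagrams and local rules -/

section Growth

variable {n : ℕ} (σ : Equiv.Perm (Fin n))

theorem mem_permIdeal {i j : ℕ} {x : ℕ × ℕ} :
    x ∈ permIdeal σ i j ↔ ∃ k : Fin n, (k : ℕ) < i ∧ (σ k : ℕ) < j ∧
      ((k : ℕ) + 1, (σ k : ℕ) + 1) = x := by
  simp only [permIdeal, permPoset, Finset.mem_inter, Finset.mem_product, Finset.mem_Icc,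
    Finset.mem_image, Finset.mem_univ, true_and]
  constructor
  · rintro ⟨h, k, rfl⟩
    exact ⟨k, by simp only at h; omega, by simp only at h; omega, rfl⟩
  · rintro ⟨k, h1, h2, rfl⟩
    exact ⟨by simp only; omega, k, rfl⟩

theorem lt_of_mem_permIdeal {i j : ℕ} {x : ℕ × ℕ} (hx : x ∈ permIdeal σ i j) :
    x.1 < i + 1 ∧ x.2 < j + 1 := by
  obtain ⟨k, h1, h2, rfl⟩ := (mem_permIdeal σ).1 hx
  exact ⟨by simpa using h1, by simpa using h2⟩

theorem permIdeal_zero_left (j : ℕ) : permIdeal σ 0 j = ∅ := by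
  simp [permIdeal]

theorem permIdeal_zero_right (i : ℕ) : permIdeal σ i 0 = ∅ := by
  simp [permIdeal]

theorem permIdeal_succ_left_of_lt (i : Fin n) {j : ℕ} (h : (σ i : ℕ) < j) :
    permIdeal σ (i + 1) j = insert ((i : ℕ) + 1, (σ i : ℕ) + 1) (permIdeal σ i j) := by
  ext x
  rw [Finset.mem_insert, mem_permIdeal, mem_permIdeal]
  constructor
  · rintro ⟨k, h1, h2, rfl⟩
    rcases Nat.lt_succ_iff_lt_or_eq.1 h1 with h1 | h1
    · exact Or.inr ⟨k, h1, h2, rfl⟩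
    · rw [Fin.ext h1]
      exact Or.inl rfl
  · rintro (rfl | ⟨k, h1, h2, rfl⟩)
    · exact ⟨i, Nat.lt_succ_self _, h, rfl⟩
    · exact ⟨k, h1.trans (Nat.lt_succ_self _), h2, rfl⟩

theorem permIdeal_succ_left_of_le (i : Fin n) {j : ℕ} (h : j ≤ (σ i : ℕ)) :
    permIdeal σ (i + 1) j = permIdeal σ i j := by
  ext x
  rw [mem_permIdeal, mem_permIdeal]
  refine exists_congr fun k => and_congr_left fun ⟨h2, _⟩ => ?_
  have : (k : ℕ) ≠ i := fun he => by
    rw [Fin.ext he] at h2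
    omega
  omega

theorem permIdeal_succ_right_of_lt {i : ℕ} (j : Fin n) (h : (σ.symm j : ℕ) < i) :
    permIdeal σ i (j + 1) = insert ((σ.symm j : ℕ) + 1, (j : ℕ) + 1) (permIdeal σ i j) := by
  ext x
  rw [Finset.mem_insert, mem_permIdeal, mem_permIdeal]
  constructor
  · rintro ⟨k, h1, h2, rfl⟩
    rcases Nat.lt_succ_iff_lt_or_eq.1 h2 with h2 | h2
    · exact Or.inr ⟨k, h1, h2, rfl⟩
    · rw [← Fin.ext h2, Equiv.symm_apply_apply]
      exact Or.inl rfl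
  · rintro (rfl | ⟨k, h1, h2, rfl⟩)
    · exact ⟨σ.symm j, h, by simp, by simp⟩
    · exact ⟨k, h1, h2.trans (Nat.lt_succ_self _), rfl⟩

theorem permIdeal_succ_right_of_le {i : ℕ} (j : Fin n) (h : i ≤ (σ.symm j : ℕ)) :
    permIdeal σ i (j + 1) = permIdeal σ i j := by
  ext x
  rw [mem_permIdeal, mem_permIdeal]
  refine exists_congr fun k => and_congr_right fun h1 => and_congr_left fun _ => ?_
  have : (σ k : ℕ) ≠ j := fun he => by
    rw [← Fin.ext he, Equiv.symm_apply_apply] at h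
    omega
  omega

/-- The four kinds of unit squares of a growth diagram. -/
theorem permIdeal_square (i j : Fin n) :
    (σ i = j ∧ permIdeal σ (i + 1) j = permIdeal σ i j ∧
      permIdeal σ i (j + 1) = permIdeal σ i j ∧
      Bump (permIdeal σ i j) (permIdeal σ (i + 1) (j + 1)) 0) ∨
    (σ i ≠ j ∧ permIdeal σ (i + 1) j = permIdeal σ i j ∧
      permIdeal σ (i + 1) (j + 1) = permIdeal σ i (j + 1)) ∨
    (σ i ≠ j ∧ permIdeal σ i (j + 1) = permIdeal σ i j ∧
      permIdeal σ (i + 1) (j + 1) = permIdeal σ (i + 1) j) ∨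
    (σ i ≠ j ∧ permIdeal σ (i + 1) j ≠ permIdeal σ i j ∧
      permIdeal σ i (j + 1) ≠ permIdeal σ i j ∧
      ∀ r s, Bump (permIdeal σ i j) (permIdeal σ (i + 1) j) r →
        Bump (permIdeal σ i j) (permIdeal σ i (j + 1)) s →
        Bump (permIdeal σ (i + 1) j) (permIdeal σ (i + 1) (j + 1)) (if r = s then r + 1 else s) ∧
        Bump (permIdeal σ i (j + 1)) (permIdeal σ (i + 1) (j + 1))
          (if r = s then r + 1 else r)) := by
  by_cases hij : σ i = j
  · left
    have h1 : permIdeal σ i (j + 1) = permIdeal σ i j :=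
      permIdeal_succ_right_of_le σ j (by simp [← hij])
    refine ⟨hij, permIdeal_succ_left_of_le σ i (by simp [hij]), h1, ?_⟩
    rw [permIdeal_succ_left_of_lt σ i (by simp [hij]), h1, hij]
    exact bump_insert_max fun q hq => lt_of_mem_permIdeal σ hq
  right
  have hne : (σ i : ℕ) ≠ j := fun h => hij (Fin.ext h)
  have hne' : (σ.symm j : ℕ) ≠ i := fun h => hij (by rw [← Fin.ext h, Equiv.apply_symm_apply])
  rcases Nat.lt_or_ge (σ i) j with hi | hi
  · rcases Nat.lt_or_ge (σ.symm j) i with hj | hj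
    · right; right
      have e1 := permIdeal_succ_left_of_lt σ i hi
      have e2 := permIdeal_succ_right_of_lt σ j hj
      have e3 := permIdeal_succ_left_of_lt σ i (hi.trans (Nat.lt_succ_self (j : ℕ)))
      rw [Nat.succ_eq_add_one, e2] at e3
      refine ⟨hij, fun h => ?_, fun h => ?_, fun r s hr hs => ?_⟩
      · have hm : ((i : ℕ) + 1, (σ i : ℕ) + 1) ∈ permIdeal σ i j := by
          rw [← h, e1]
          exact Finset.mem_insert_self _ _
        exact lt_irrefl _ (lt_of_mem_permIdeal σ hm).1
      · have hm : ((σ.symm j : ℕ) + 1, (j : ℕ) + 1) ∈ permIdeal σ i j := by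
          rw [← h, e2]
          exact Finset.mem_insert_self _ _
        exact lt_irrefl _ (lt_of_mem_permIdeal σ hm).2
      · rw [e1] at hr ⊢
        rw [e2] at hs ⊢
        rw [e3]
        exact chainNum_insert_insert (fun q hq => lt_of_mem_permIdeal σ hq) (by omega) (by omega)
          hr hs
    · right; left
      exact ⟨hij, permIdeal_succ_right_of_le σ j hj, permIdeal_succ_right_of_le σ j (by omega)⟩
  · left
    exact ⟨hij, permIdeal_succ_left_of_le σ i hi, permIdeal_succ_left_of_le σ i (by omega)⟩

/-- Consecutive ideals are equal or their shapes differ by one box. -/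
theorem permIdeal_step (m : ℕ) : ∀ i j : ℕ, i + j = m →
    (i < n → j ≤ n → permIdeal σ (i + 1) j = permIdeal σ i j ∨
      ∃ r, Bump (permIdeal σ i j) (permIdeal σ (i + 1) j) r) ∧
    (j < n → i ≤ n → permIdeal σ i (j + 1) = permIdeal σ i j ∨
      ∃ r, Bump (permIdeal σ i j) (permIdeal σ i (j + 1)) r) := by
  induction m with
  | zero =>
    intro i j h
    obtain ⟨rfl, rfl⟩ : i = 0 ∧ j = 0 := by omega
    simp [permIdeal_zero_left, permIdeal_zero_right]
  | succ m ih =>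
    intro i j h
    constructor
    · intro hi hj
      rcases j with _ | j
      · simp [permIdeal_zero_right]
      -- The edge in question is a far side of the unit square at `(i, j)`, whose two near sides are
      -- covered by the induction hypothesis.
      obtain ⟨h1, h2⟩ := ih i j (by omega)
      specialize h1 hi (by omega)
      specialize h2 hj hi.le
      rcases permIdeal_square σ ⟨i, hi⟩ ⟨j, hj⟩ with ⟨-, -, e2, e⟩ | ⟨-, -, e⟩ | ⟨-, e2, e⟩ |
        ⟨-, n1, n2, e⟩
      · simp only at e2 e
        rw [e2]
        exact Or.inr ⟨0, e⟩
      · exact Or.inl e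
      · simp only at e2 e
        rw [e, e2]
        exact h1
      · obtain ⟨r, hr⟩ := h1.resolve_left n1
        obtain ⟨s, hs⟩ := h2.resolve_left n2
        exact Or.inr ⟨_, (e r s hr hs).2⟩
    · intro hj hi
      rcases i with _ | i
      · simp [permIdeal_zero_left]
      obtain ⟨h1, h2⟩ := ih i j (by omega)
      specialize h1 hi hj.le
      specialize h2 hj (by omega)
      rcases permIdeal_square σ ⟨i, hi⟩ ⟨j, hj⟩ with ⟨-, e1, -, e⟩ | ⟨-, e1, e⟩ | ⟨-, -, e⟩ |
        ⟨-, n1, n2, e⟩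
      · simp only at e1 e
        rw [e1]
        exact Or.inr ⟨0, e⟩
      · simp only at e1 e
        rw [e, e1]
        exact h2
      · exact Or.inl e
      · obtain ⟨r, hr⟩ := h1.resolve_left n1
        obtain ⟨s, hs⟩ := h2.resolve_left n2
        exact Or.inr ⟨_, (e r s hr hs).1⟩

/-- The four growth rules, as a relation between the corners of a unit square. -/
def LocalRule (lam nu mu : YoungDiagram) (w : Prop) (rho : YoungDiagram) : Prop :=
  (nu ≠ mu → rho = nu ⊔ mu) ∧
  (nu = mu → mu = lam → ¬ w → rho = lam) ∧
  (nu = mu → mu = lam → w → ∃ B : ℕ × ℕ, B.1 = 0 ∧ AddsBox lam B rho) ∧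
  (nu = mu → mu ≠ lam → ∃ A B : ℕ × ℕ, AddsBox lam A mu ∧ B.1 = A.1 + 1 ∧ AddsBox mu B rho)

/-- The row of an added box determines the new diagram, and the row of `A` is recovered from `lam`
and `mu`. This is what makes a universal rule possible. -/
theorem LocalRule.unique {lam nu mu rho rho' : YoungDiagram} {w : Prop}
    (h : LocalRule lam nu mu w rho) (h' : LocalRule lam nu mu w rho') : rho = rho' := by
  by_cases h1 : nu = mu
  · by_cases h2 : mu = lam
    · by_cases hw : w
      · obtain ⟨B, hB, hb⟩ := h.2.2.1 h1 h2 hw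
        obtain ⟨B', hB', hb'⟩ := h'.2.2.1 h1 h2 hw
        exact hb.eq_of_row_eq hb' (hB.trans hB'.symm)
      · rw [h.2.1 h1 h2 hw, h'.2.1 h1 h2 hw]
    · obtain ⟨A, B, hA, hAB, hB⟩ := h.2.2.2 h1 h2
      obtain ⟨A', B', hA', hAB', hB'⟩ := h'.2.2.2 h1 h2
      exact hB.eq_of_row_eq hB' (by rw [hAB, hAB', hA.row_eq hA'])
  · rw [h.1 h1, h'.1 h1]

theorem shape_sup_of_step {P Q : Finset (ℕ × ℕ)} (h : P = Q ∨ ∃ r, Bump Q P r) :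
    shape Q ⊔ shape P = shape P := by
  refine sup_eq_right.2 ?_
  rcases h with rfl | ⟨r, hr⟩
  · exact le_rfl
  · rw [← YoungDiagram.cells_subset_iff, hr.addsBox.2]
    exact Finset.subset_insert _ _

theorem shape_eq_of_bump {Q P P' : Finset (ℕ × ℕ)} {r : ℕ} (h : Bump Q P r) (h' : Bump Q P' r) :
    shape P = shape P' :=
  youngDiagram_ext_rowLen fun k => by rw [h.rowLen_eq, h'.rowLen_eq]

theorem Bump.shape_ne {Q P : Finset (ℕ × ℕ)} {r : ℕ} (h : Bump Q P r) : shape P ≠ shape Q := by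
  intro he
  have := h.rowLen_eq r
  rw [he, if_pos rfl] at this
  omega

theorem localRule_growth (i j : Fin n) :
    LocalRule (growth σ i j) (growth σ (i + 1) j) (growth σ i (j + 1)) (σ i = j)
      (growth σ (i + 1) (j + 1)) := by
  obtain ⟨h1, h2⟩ := permIdeal_step σ _ i j rfl
  specialize h1 i.2 j.2.le
  specialize h2 j.2 i.2.le
  simp only [growth]
  rcases permIdeal_square σ i j with ⟨hw, e1, e2, e⟩ | ⟨hw, e1, e⟩ | ⟨hw, e2, e⟩ |
    ⟨hw, n1, n2, e⟩
  · rw [e1, e2]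
    exact ⟨fun h => absurd rfl h, fun _ _ h => absurd hw h, fun _ _ _ => ⟨_, rfl, e.addsBox⟩,
      fun _ h => absurd rfl h⟩
  · rw [e1, e]
    exact ⟨fun _ => (shape_sup_of_step h2).symm, fun _ h _ => h, fun _ _ h => absurd h hw,
      fun h h' => absurd h.symm h'⟩
  · rw [e2, e]
    exact ⟨fun _ => (sup_comm _ _).trans (shape_sup_of_step h1) |>.symm, fun h _ _ => h,
      fun _ _ h => absurd h hw, fun _ h => absurd rfl h⟩
  · obtain ⟨r, hr⟩ := h1.resolve_left n1
    obtain ⟨s, hs⟩ := h2.resolve_left n2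
    obtain ⟨b1, b2⟩ := e r s hr hs
    refine ⟨fun hne => ?_, fun _ h _ => absurd h hs.shape_ne, fun _ h _ => absurd h hs.shape_ne,
      fun he _ => ?_⟩
    · have hrs : r ≠ s := fun h => hne (shape_eq_of_bump hr (h ▸ hs))
      rw [if_neg hrs] at b1
      -- As `r ≠ s`, each row receives at most one of the two boxes, so its final length is the
      -- larger of the two intermediate ones.
      refine SetLike.ext fun z => ?_
      obtain ⟨u, v⟩ := z
      rw [YoungDiagram.mem_sup]
      simp only [YoungDiagram.mem_iff_lt_rowLen]
      rw [b1.rowLen_eq, hr.rowLen_eq, hs.rowLen_eq]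
      split_ifs <;> omega
    · have hrs : r = s := by
        by_contra hne
        have h3 := hr.rowLen_eq r
        rw [he, hs.rowLen_eq, if_pos rfl, if_neg hne] at h3
        omega
      rw [if_pos hrs] at b2
      exact ⟨_, _, hs.addsBox, congrArg (· + 1) hrs, b2.addsBox⟩

end Growth

end Greene

/-- For `i j : Fin n` the unit square has corners `(i, j)` and `(i + 1, j + 1)`, and `σ i = j` says
that the permutation of `{1, …, n}` sends `i + 1` to `j + 1`. Row `0` is the first row. -/
theorem theorem3p1 :
    -- every entry of every growth diagram is a genuine shape
    (∀ (n : ℕ) (σ : Equiv.Perm (Fin n)) (i j : ℕ), i ≤ n → j ≤ n →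
      Greene.IsShape (Greene.permIdeal σ i j) (Greene.growth σ i j)) ∧
    -- one universal local rule determines the northeast corner
    (∃ F : YoungDiagram → YoungDiagram → YoungDiagram → Prop → YoungDiagram,
      ∀ (n : ℕ) (σ : Equiv.Perm (Fin n)) (i j : Fin n),
        Greene.growth σ (i + 1) (j + 1) =
          F (Greene.growth σ i j) (Greene.growth σ (i + 1) j) (Greene.growth σ i (j + 1))
            (σ i = j)) ∧
    -- the four explicit rules
    (∀ (n : ℕ) (σ : Equiv.Perm (Fin n)) (i j : Fin n),
      (Greene.growth σ (i + 1) j ≠ Greene.growth σ i (j + 1) →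
        Greene.growth σ (i + 1) (j + 1) =
          Greene.growth σ (i + 1) j ⊔ Greene.growth σ i (j + 1)) ∧
      (Greene.growth σ (i + 1) j = Greene.growth σ i (j + 1) →
        Greene.growth σ i (j + 1) = Greene.growth σ i j →
        σ i ≠ j →
        Greene.growth σ (i + 1) (j + 1) = Greene.growth σ i j) ∧
      (Greene.growth σ (i + 1) j = Greene.growth σ i (j + 1) →
        Greene.growth σ i (j + 1) = Greene.growth σ i j →
        σ i = j →
        ∃ B : ℕ × ℕ, B.1 = 0 ∧
          Greene.AddsBox (Greene.growth σ i j) B (Greene.growth σ (i + 1) (j + 1))) ∧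
      (Greene.growth σ (i + 1) j = Greene.growth σ i (j + 1) →
        Greene.growth σ i (j + 1) ≠ Greene.growth σ i j →
        ∃ A B : ℕ × ℕ,
          Greene.AddsBox (Greene.growth σ i j) A (Greene.growth σ i (j + 1)) ∧
          B.1 = A.1 + 1 ∧
          Greene.AddsBox (Greene.growth σ i (j + 1)) B (Greene.growth σ (i + 1) (j + 1)))) := by
  classical
  -- The universal rule chooses a diagram allowed by `LocalRule`, and uniqueness makes the choice
  -- harmless. The default `⊥` is reached only for data that no unit square of a growth diagram
  -- produces.
  refine ⟨fun n σ i j _ _ => Greene.isShape_shape _,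
    ⟨fun lam nu mu w => if h : ∃ rho, Greene.LocalRule lam nu mu w rho then h.choose else ⊥,
      fun n σ i j => ?_⟩, fun n σ i j => Greene.localRule_growth σ i j⟩
  have h : ∃ rho, Greene.LocalRule (Greene.growth σ i j) (Greene.growth σ (i + 1) j)
      (Greene.growth σ i (j + 1)) (σ i = j) rho := ⟨_, Greene.localRule_growth σ i j⟩
  beta_reduce
  rw [dif_pos h]
  exact (Greene.localRule_growth σ i j).unique h.choose_spec
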